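/- \textbf{Setting.} Let $u,m\ge 1$, $n=u+m$, $\mathcal X\subseteq\mathbb R^{D}$, $\mathcal Y\subseteq\mathbb R$, and let $(x_i,y_i)_{i=1}^n$ be points of $\mathcal X\times\mathcal Y$ (the full sample). For $h:\mathcal X\times\mathcal Y\to\mathbb R$ write $h(i)=h(x_i,y_i)$, $\mathcal L_n(h)=\frac1n\sum_{i=1}^n h(i)$ and $T_n(h)=\frac1n\sum_{i=1}^n h(i)^2$. Let $\mathbf d=(d_1,\dots,d_u)$ have independent entries, $d_i$ uniform on $\{i,\dots,n\}$. The RANDPERM algorithm produces the vector $\mathbf Z_{\mathbf d}$ from $\mathbf d$: start with the array $I=(1,\dots,n)$ and, for $i=1,\dots,u$, put $\mathbf Z_{\mathbf d}(i)=I(d_i)$ and then swap the values $I(i)$ and $I(d_i)$; so $\mathbf Z_{\mathbf d}$ lists $u$ indices sampled uniformly without replacement from $\{1,\dots,n\}$. Let $\{\mathbf Z_{\mathbf d}\}$ be the set of test indices, $\overline{\mathbf Z_{\mathbf d}}$ its complement (the training indices), and $$\mathcal U^{(u)}_h(\mathbf Z_{\mathbf d})=\frac1u\sum_{i\in\{\mathbf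 Z_{\mathbf d}\}}h(i),\qquad \mathcal L^{(m)}_h(\overline{\mathbf Z_{\mathbf d}})=\frac1m\sum_{i\in\overline{\mathbf Z_{\mathbf d}}}h(i),$$ $$R^+_{u,\mathbf d}h=\mathcal U^{(u)}_h(\mathbf Z_{\mathbf d})-\mathcal L_n(h),\qquad R^+_{m,\mathbf d}h=\mathcal L^{(m)}_h(\overline{\mathbf Z_{\mathbf d}})-\mathcal L_n(h),\qquad R^-_{m,\mathbf d}h=-R^+_{m,\mathbf d}h .$$ Let $\ell:\mathbb R\times\mathcal Y\to\mathbb R$ be a loss function, $\mathcal F$ a class of functions $f:\mathcal X\to\mathbb R$, $\ell_f(x,y)=\ell(f(x),y)$, and $\Delta_{\mathcal F}=\{\ell_{f_1}-\ell_{f_2}: f_1,f_2\in\mathcal F\}$. Assume $0\le \ell_f(i)\le L_0$ for all $f\in\mathcal F$ and $1\le i\le n$, where $L_0\ge 2\sqrt2$. \textbf{Main Assumption.} (1) There is $f_n^*\in\mathcal F$ with $\mathcal L_n(\ell_{f_n^*})=\inf_{f\in\mathcal F}\mathcal L_n(\ell_f)$. (2) There is a constant $B$ such that $T_n(\ell_f-\ell_{f_n^*})\le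 B\,\mathcal L_n(\ell_f-\ell_{f_n^*})$ for all $f\in\mathcal F$. A function $\psi:[0,\infty)\to[0,\infty)$ is \emph{sub-root} if it is nondecreasing and $r\mapsto\psi(r)/\sqrt r$ is nonincreasing on $(0,\infty)$. Its \emph{fixed point} is the largest $r\ge0$ with $\psi(r)=r$; this is the unique positive solution of $\psi(r)=r$ unless $\psi\equiv0$. \textbf{Theorem.} Fix $K>1$. There are a constant $c_0>0$ depending only on $K$ and a constant $c_1>0$ depending only on $K$ and $L_0$ such that the following holds in every such setting satisfying the Main Assumption. For $h\in\Delta_{\mathcal F}$ let $$\tilde T_n(h)=\inf_{f_1,f_2\in\mathcal F:\ \ell_{f_1}-\ell_{f_2}=h}\Bigl(2B\,\mathcal L_n(\ell_{f_1}-\ell_{f_n^*})+2B\,\mathcal L_n(\ell_{f_2}-\ell_{f_n^*})\Bigr).$$ Let $\psi_u,\psi_m$ be sub-root functions with fixed points $r_u,r_m$, such that for all $r\ge r_u$ $$\psi_u(r)\ge\max\Bigl\{\mathbb E_{\mathbf d}\Bigl[\sup_{h\in\Delta_{\mathcal F},\,\tilde T_n(h)\le r}R^+_{u,\mathbf d}h\Bigr],\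 \mathbb E_{\mathbf d}\Bigl[\sup_{h\in\Delta_{\mathcal F},\,\tilde T_n(h)\le r}R^+_{u,\mathbf d}h^2\Bigr]\Bigr\},$$ and for all $r\ge r_m$ $$\psi_m(r)\ge\max\Bigl\{\mathbb E_{\mathbf d}\Bigl[\sup_{h\in\Delta_{\mathcal F},\,\tilde T_n(h)\le r}R^-_{m,\mathbf d}h\Bigr],\ \mathbb E_{\mathbf d}\Bigl[\sup_{h\in\Delta_{\mathcal F},\,\tilde T_n(h)\le r}R^+_{m,\mathbf d}h^2\Bigr]\Bigr\}.$$ Then for every $x>0$, with probability at least $1-e^{-x}$ over $\mathbf d$, simultaneously for all $h\in\Delta_{\mathcal F}$ and all $f_1,f_2\in\mathcal F$ with $h=\ell_{f_1}-\ell_{f_2}$, $$\mathcal U^{(u)}_h(\mathbf Z_{\mathbf d})\le\mathcal L^{(m)}_h(\overline{\mathbf Z_{\mathbf d}})+\frac{2B}{K}\Bigl(\mathcal L_n(\ell_{f_1}-\ell_{f_n^*})+\mathcal L_n(\ell_{f_2}-\ell_{f_n^*})\Bigr)+c_0(r_u+r_m)+\frac{c_1x}{\min\{m,u\}}.$$ 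-/

import Mathlib

open MeasureTheory ProbabilityTheory

namespace TLC

noncomputable section

/-! ### Sampling without replacement by the RANDPERM algorithm -/

/-- The law of the random vector `d = (d_1, …, d_u)` whose entries are independent, the `i`-th one
being uniform on the positions `i, i + 1, …, n`, where `n = u + m` (positions are numbered from `0`
here). -/
def drawLaw (u m : ℕ) : Measure (Fin u → Fin (u + m)) :=
  Measure.pi fun i : Fin u => uniformOn (Set.Ici (Fin.castAdd m i))

/-- The array `I` after `k` rounds of RANDPERM: it starts as the identity, and round `i` swaps the
values of `I(i)` and `I(d_i)`. -/
def permArray {u m : ℕ} (d : Fin u → Fin (u + m)) : ℕ → Equiv.Perm (Fin (u + m))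
  | 0 => 1
  | k + 1 =>
    if hk : k < u then
      permArray d k * Equiv.swap (Fin.castAdd m ⟨k, hk⟩) (d ⟨k, hk⟩)
    else permArray d k

/-- The output vector `Z_d` of RANDPERM: round `i` sets `Z_d(i) = I(d_i)` before the swap. -/
def drawnIndex {u m : ℕ} (d : Fin u → Fin (u + m)) (i : Fin u) : Fin (u + m) :=
  permArray d i (d i)

/-- The index set `{Z_d}` of the test points. -/
def testSet {u m : ℕ} (d : Fin u → Fin (u + m)) : Finset (Fin (u + m)) :=
  Finset.univ.image (drawnIndex d)

/-- The index set of the training points, the complement of `{Z_d}`. -/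
def trainSet {u m : ℕ} (d : Fin u → Fin (u + m)) : Finset (Fin (u + m)) :=
  (testSet d)ᶜ

/-! ### Losses; `S` is the full sample, a family of `n` labelled points, and `h(i) = h (S i)` -/

/-- The average `L_n(h)` of `h` over the full sample. -/
def avgLoss {α : Type*} {n : ℕ} (S : Fin n → α) (h : α → ℝ) : ℝ :=
  1 / (n : ℝ) * ∑ i, h (S i)

/-- The average `T_n(h)` of the square of `h` over the full sample. -/
def avgSqLoss {α : Type*} {n : ℕ} (S : Fin n → α) (h : α → ℝ) : ℝ :=
  1 / (n : ℝ) * ∑ i, h (S i) ^ 2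

/-- The test loss `U_h^{(u)}(Z_d)`. -/
def testLoss {α : Type*} {u m : ℕ} (S : Fin (u + m) → α) (d : Fin u → Fin (u + m))
    (h : α → ℝ) : ℝ :=
  1 / (u : ℝ) * ∑ i ∈ testSet d, h (S i)

/-- The training loss `L_h^{(m)}`, on the complement of `{Z_d}`. -/
def trainLoss {α : Type*} {u m : ℕ} (S : Fin (u + m) → α) (d : Fin u → Fin (u + m))
    (h : α → ℝ) : ℝ :=
  1 / (m : ℝ) * ∑ i ∈ trainSet d, h (S i)

/-- `R^+_{u,d} h`. -/
def testDev {α : Type*} {u m : ℕ} (S : Fin (u + m) → α) (d : Fin u → Fin (u + m))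
    (h : α → ℝ) : ℝ :=
  1 / (u : ℝ) * ∑ i : Fin u, h (S (drawnIndex d i)) - avgLoss S h

/-- `R^+_{m,d} h`; the quantity `R^-_{m,d} h` is its negative. -/
def trainDev {α : Type*} {u m : ℕ} (S : Fin (u + m) → α) (d : Fin u → Fin (u + m))
    (h : α → ℝ) : ℝ :=
  trainLoss S d h - avgLoss S h

/-- `E_d [ sup_{h ∈ H} Φ(d, h) ]`. -/
def expSup {β : Type*} (u m : ℕ) (H : Set β) (Φ : (Fin u → Fin (u + m)) → β → ℝ) : ℝ :=
  ∫ d, (⨆ h : H, Φ d h) ∂(drawLaw u m)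

/-! ### Sub-root functions -/

/-- Sub-root functions on `[0, ∞)`; values at negative arguments are irrelevant. -/
structure IsSubRoot (ψ : ℝ → ℝ) : Prop where
  nonneg : ∀ r, 0 ≤ r → 0 ≤ ψ r
  mono : MonotoneOn ψ (Set.Ici 0)
  anti : AntitoneOn (fun r => ψ r / Real.sqrt r) (Set.Ioi 0)

/-- The fixed point of a sub-root function: its largest fixed point on `[0, ∞)`. If `ψ` is not
identically zero, this is the unique positive solution of `ψ r = r` (the point `0`, which may
solve the equation too, is not meant then). -/
def IsFixedPointOf (ψ : ℝ → ℝ) (r : ℝ) : Prop :=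
  IsGreatest {s : ℝ | 0 ≤ s ∧ ψ s = s} r

/-! ### Loss classes; `F` is the class of prediction functions -/

/-- The loss function `ℓ_f (x, y) = ℓ(f(x), y)` of a prediction function `f`. -/
def lossFun {X Y : Type*} (ℓ : ℝ → Y → ℝ) (f : X → ℝ) : X × Y → ℝ :=
  fun p => ℓ (f p.1) p.2

/-- The class `Δ_F` of differences `ℓ_{f₁} - ℓ_{f₂}` with `f₁, f₂ ∈ F`. -/
def lossDiffClass {X Y : Type*} (ℓ : ℝ → Y → ℝ) (F : Set (X → ℝ)) : Set (X × Y → ℝ) :=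
  {h | ∃ f₁ ∈ F, ∃ f₂ ∈ F, h = lossFun ℓ f₁ - lossFun ℓ f₂}

/-- The Main Assumption, for the minimizer `fstar` and the constant `B`. -/
structure MainAssumption {X Y : Type*} {n : ℕ} (ℓ : ℝ → Y → ℝ) (F : Set (X → ℝ))
    (S : Fin n → X × Y) (fstar : X → ℝ) (B : ℝ) : Prop where
  mem : fstar ∈ F
  minimizes : ∀ f ∈ F, avgLoss S (lossFun ℓ fstar) ≤ avgLoss S (lossFun ℓ f)
  sq_le : ∀ f ∈ F, avgSqLoss S (lossFun ℓ f - lossFun ℓ fstar)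
    ≤ B * avgLoss S (lossFun ℓ f - lossFun ℓ fstar)

/-- The surrogate variance `T̃_n(h)`: the infimum of
`2B L_n(ℓ_{f₁} - ℓ_{f*}) + 2B L_n(ℓ_{f₂} - ℓ_{f*})` over the representations
`ℓ_{f₁} - ℓ_{f₂} = h` with `f₁, f₂ ∈ F`. -/
def surrogateVar {X Y : Type*} {n : ℕ} (ℓ : ℝ → Y → ℝ) (F : Set (X → ℝ))
    (S : Fin n → X × Y) (fstar : X → ℝ) (B : ℝ) (h : X × Y → ℝ) : ℝ :=
  sInf {t : ℝ | ∃ f₁ ∈ F, ∃ f₂ ∈ F, lossFun ℓ f₁ - lossFun ℓ f₂ = h ∧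
    t = 2 * B * avgLoss S (lossFun ℓ f₁ - lossFun ℓ fstar)
      + 2 * B * avgLoss S (lossFun ℓ f₂ - lossFun ℓ fstar)}

/-- The localized class `{h ∈ Δ_F : T̃_n(h) ≤ r}`. -/
def localClass {X Y : Type*} {n : ℕ} (ℓ : ℝ → Y → ℝ) (F : Set (X → ℝ))
    (S : Fin n → X × Y) (fstar : X → ℝ) (B : ℝ) (r : ℝ) : Set (X × Y → ℝ) :=
  {h | h ∈ lossDiffClass ℓ F ∧ surrogateVar ℓ F S fstar B h ≤ r}

end

end TLC

/-!
The entropy of a function on the `k`-subsets of a finite set `s` satisfies a modified logarithmic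
Sobolev inequality for the walk that exchanges a sampled point for an unsampled one; it is proved by
induction on `s`, averaging over the point of `s` that is removed. By Herbst's argument a function
that decreases little under exchanges concentrates. A small multiple `θ` of the supremum of the
empirical second moments, plus `θ r`, added to the supremum of the deviations yields a `Z` whose
squared decreases are bounded by a multiple of `Z` itself. So `√Z` concentrates, and this gives a
Talagrand type inequality for sampling without replacement.

It is applied to the loss differences `h` multiplied by `r / max r (T̃_n h)`: these have variance at
most `r`, and since `ψ` is sub-root their expected supremum is at most `4 ψ r`, which is small
compared with `r` once `r` is a large multiple of the fixed point. Finally, the deviation of the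
mean over the smaller of the test and training sets from the full mean is at least half of the
difference between the two means.
-/

namespace TLC

open Finset
open scoped BigOperators

/-! ### Entropy on a finite set -/

section Entropy

variable {ι : Type*}

/-- The integrand `(x - y) (log x - log y)` of the entropic Dirichlet form. -/
noncomputable def logDiff (x y : ℝ) : ℝ :=
  (x - y) * (Real.log x - Real.log y)

/-- The entropy of `f` under the counting measure of `P`, hence `#P` times its entropy under the
uniform law on `P`. -/
noncomputable def ent (P : Finset ι) (f : ι → ℝ) : ℝ :=
  ∑ i ∈ P, f i * Real.log (f i) - (∑ i ∈ P, f i) * Real.log (𝔼 i ∈ P, f i)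

lemma logDiff_nonneg {x y : ℝ} (hx : 0 < x) (hy : 0 < y) : 0 ≤ logDiff x y := by
  rcases le_total x y with h | h
  · exact mul_nonneg_of_nonpos_of_nonpos (sub_nonpos.2 h) (sub_nonpos.2 (Real.log_le_log hx h))
  · exact mul_nonneg (sub_nonneg.2 h) (sub_nonneg.2 (Real.log_le_log hy h))

lemma logDiff_div {c x y : ℝ} (hc : 0 < c) (hx : 0 < x) (hy : 0 < y) :
    logDiff (x / c) (y / c) = logDiff x y / c := by
  unfold logDiff
  rw [Real.log_div hx.ne' hc.ne', Real.log_div hy.ne' hc.ne']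
  ring

lemma log_sum_inequality {s : Finset ι} {x y : ι → ℝ} (hx : ∀ i ∈ s, 0 < x i)
    (hy : ∀ i ∈ s, 0 < y i) :
    (∑ i ∈ s, x i) * (Real.log (∑ i ∈ s, x i) - Real.log (∑ i ∈ s, y i))
      ≤ ∑ i ∈ s, x i * (Real.log (x i) - Real.log (y i)) := by
  rcases s.eq_empty_or_nonempty with rfl | hs
  · simp
  set X := ∑ i ∈ s, x i
  set Y := ∑ i ∈ s, y i
  have hX : 0 < X := sum_pos hx hs
  have hY : 0 < Y := sum_pos hy hs
  have tangent : ∀ i ∈ s, x i * (Real.log X - Real.log Y) + (x i - y i * (X / Y))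
      ≤ x i * (Real.log (x i) - Real.log (y i)) := by
    intro i hi
    have hxi := hx i hi
    have hyi := hy i hi
    have h := Real.one_sub_inv_le_log_of_pos (x := x i / y i / (X / Y)) (by positivity)
    rw [Real.log_div (by positivity) (by positivity), Real.log_div hxi.ne' hyi.ne',
      Real.log_div hX.ne' hY.ne'] at h
    have h_linear : x i * (1 - (x i / y i / (X / Y))⁻¹) = x i - y i * (X / Y) := by
      field_simp
    linarith [mul_le_mul_of_nonneg_left h hxi.le]
  have h := sum_le_sum tangent
  rw [sum_add_distrib, sum_sub_distrib, ← sum_mul, ← sum_mul, mul_div_cancel₀ _ hY.ne',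
    sub_self, add_zero] at h
  exact h

lemma logDiff_sum_le {s : Finset ι} {x y : ι → ℝ} (hx : ∀ i ∈ s, 0 < x i)
    (hy : ∀ i ∈ s, 0 < y i) :
    logDiff (∑ i ∈ s, x i) (∑ i ∈ s, y i) ≤ ∑ i ∈ s, logDiff (x i) (y i) := by
  have split (a b : ℝ) : logDiff a b
      = a * (Real.log a - Real.log b) + b * (Real.log b - Real.log a) := by
    unfold logDiff
    ring
  simp only [split, sum_add_distrib]
  exact add_le_add (log_sum_inequality hx hy) (log_sum_inequality hy hx)

lemma logDiff_expect_le {s : Finset ι} {x y : ι → ℝ} (hs : s.Nonempty)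
    (hx : ∀ i ∈ s, 0 < x i) (hy : ∀ i ∈ s, 0 < y i) :
    logDiff (𝔼 i ∈ s, x i) (𝔼 i ∈ s, y i) ≤ 𝔼 i ∈ s, logDiff (x i) (y i) := by
  have hcard : (0 : ℝ) < #s := by exact_mod_cast hs.card_pos
  simp only [expect_eq_sum_div_card]
  rw [logDiff_div hcard (sum_pos hx hs) (sum_pos hy hs)]
  gcongr
  exact logDiff_sum_le hx hy

lemma logDiff_exp_le_of_le {x y : ℝ} (h : y ≤ x) :
    logDiff (Real.exp x) (Real.exp y) ≤ Real.exp x * (x - y) ^ 2 := by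
  have h_slope : Real.exp x - Real.exp y ≤ Real.exp x * (x - y) := by
    have h_tangent := mul_le_mul_of_nonneg_left (Real.add_one_le_exp (y - x)) (Real.exp_pos x).le
    rw [← Real.exp_add, add_sub_cancel] at h_tangent
    linarith
  calc logDiff (Real.exp x) (Real.exp y)
      = (Real.exp x - Real.exp y) * (x - y) := by rw [logDiff, Real.log_exp, Real.log_exp]
    _ ≤ Real.exp x * (x - y) * (x - y) := mul_le_mul_of_nonneg_right h_slope (sub_nonneg.2 h)
    _ = Real.exp x * (x - y) ^ 2 := by ring

lemma logDiff_comm (x y : ℝ) : logDiff x y = logDiff y x := by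
  unfold logDiff
  ring

lemma logDiff_exp_le (x y : ℝ) :
    logDiff (Real.exp x) (Real.exp y)
      ≤ Real.exp x * (x - y)⁺ ^ 2 + Real.exp y * (y - x)⁺ ^ 2 := by
  rcases le_total y x with h | h
  · rw [posPart_of_nonneg (sub_nonneg.2 h), posPart_of_nonpos (sub_nonpos.2 h)]
    simpa using logDiff_exp_le_of_le h
  · rw [posPart_of_nonpos (sub_nonpos.2 h), posPart_of_nonneg (sub_nonneg.2 h), logDiff_comm]
    simpa using logDiff_exp_le_of_le h

lemma two_point_entropy_le {p q x y : ℝ} (hp : 0 < p) (hq : 0 < q) (hx : 0 < x) (hy : 0 < y) :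
    p * x * Real.log x + q * y * Real.log y
        - (p * x + q * y) * Real.log ((p * x + q * y) / (p + q))
      ≤ p * q / (p + q) * logDiff x y := by
  have h_concave := strictConcaveOn_log_Ioi.concaveOn.2 (Set.mem_Ioi.2 hx) (Set.mem_Ioi.2 hy)
    (div_nonneg hp.le (add_pos hp hq).le) (div_nonneg hq.le (add_pos hp hq).le) (by field_simp)
  simp only [smul_eq_mul, div_mul_eq_mul_div, ← add_div] at h_concave
  have h_mul := mul_le_mul_of_nonneg_left h_concave (show 0 ≤ p * x + q * y by positivity)
  have h_diff : p * x * Real.log x + q * y * Real.log y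
      - (p * x + q * y) * ((p * Real.log x + q * Real.log y) / (p + q))
      = p * q / (p + q) * logDiff x y := by
    unfold logDiff
    field_simp
    ring
  linarith

lemma ent_disjUnion_le {P Q : Finset ι} (hPQ : Disjoint P Q) (hP : P.Nonempty)
    (hQ : Q.Nonempty) {f : ι → ℝ} (hf : ∀ i, 0 < f i) :
    ent (P.disjUnion Q hPQ) f ≤ ent P f + ent Q f
      + #P * #Q / (#P + #Q) * logDiff (𝔼 i ∈ P, f i) (𝔼 i ∈ Q, f i) := by
  have h := two_point_entropy_le (p := #P) (q := #Q) (by exact_mod_cast hP.card_pos)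
    (by exact_mod_cast hQ.card_pos) (expect_pos (fun i _ => hf i) hP)
    (expect_pos (fun i _ => hf i) hQ)
  have h_mean : 𝔼 i ∈ P.disjUnion Q hPQ, f i = (∑ i ∈ P, f i + ∑ i ∈ Q, f i) / (#P + #Q) := by
    rw [expect_eq_sum_div_card, sum_disjUnion, card_disjUnion, Nat.cast_add]
  simp only [card_mul_expect] at h
  unfold ent
  rw [h_mean, sum_disjUnion, sum_disjUnion]
  linarith

lemma ent_eq_zero_of_card_le_one {P : Finset ι} (hP : #P ≤ 1) (f : ι → ℝ) : ent P f = 0 := by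
  rcases P.eq_empty_or_nonempty with rfl | hne
  · simp [ent]
  · obtain ⟨i, rfl⟩ := card_eq_one.1 (le_antisymm hP hne.card_pos)
    simp [ent]

end Entropy

/-! ### A modified logarithmic Sobolev inequality for uniform random subsets -/

section Slice

variable {α : Type*}

lemma card_powersetCard_le_one {s : Finset α} {k : ℕ} (hk : #s ≤ k) : #(s.powersetCard k) ≤ 1 := by
  rw [card_powersetCard]
  exact (Nat.choose_le_choose k hk).trans_eq (Nat.choose_self k)

lemma card_powersetCard_succ_mul {s : Finset α} {k : ℕ} (hk : k ≤ #s) :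
    (#(s.powersetCard (k + 1)) : ℝ) * (k + 1) = #(s.powersetCard k) * (#s - k) := by
  rw [card_powersetCard, card_powersetCard, ← Nat.cast_sub hk]
  exact_mod_cast Nat.choose_succ_right_eq #s k

lemma card_powersetCard_mul_div_add {s : Finset α} {k : ℕ} (hk : k < #s) :
    (#(s.powersetCard k) : ℝ) * #(s.powersetCard (k + 1))
        / (#(s.powersetCard k) + #(s.powersetCard (k + 1))) / (#(s.powersetCard k) * (#s - k))
      = 1 / (#s + 1) := by
  have hp : (0 : ℝ) < #(s.powersetCard k) := by
    exact_mod_cast (powersetCard_nonempty.2 hk.le).card_pos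
  have hnk : (0 : ℝ) < #s - k := sub_pos.2 (by exact_mod_cast hk)
  have h_choose := card_powersetCard_succ_mul hk.le
  field_simp
  linear_combination h_choose

variable [DecidableEq α]

/-- The set `W` with its element `a` exchanged for `b`. -/
def exchange (W : Finset α) (a b : α) : Finset α :=
  insert b (W.erase a)

/-- The sum of `H W a b` over all moves of the exchange walk on the `k`-subsets `W` of `s`:
an element `a` of `W` leaves and an element `b` of `s` outside `W` enters. -/
def exchangeSum (s : Finset α) (k : ℕ) (H : Finset α → α → α → ℝ) : ℝ :=
  ∑ W ∈ s.powersetCard k, ∑ a ∈ W, ∑ b ∈ s \ W, H W a b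

lemma powersetCard_succ_eq_disjUnion {s : Finset α} {v : α} (hv : v ∈ s) (k : ℕ) :
    ∃ h : Disjoint (((s.erase v).powersetCard k).image (insert v))
        ((s.erase v).powersetCard (k + 1)),
      s.powersetCard (k + 1) = (((s.erase v).powersetCard k).image (insert v)).disjUnion
        ((s.erase v).powersetCard (k + 1)) h := by
  have h_disj : Disjoint (((s.erase v).powersetCard k).image (insert v))
      ((s.erase v).powersetCard (k + 1)) := by
    refine disjoint_left.2 fun V hV hV' => ?_
    obtain ⟨W, -, rfl⟩ := mem_image.1 hV
    exact notMem_erase v s ((mem_powersetCard.1 hV').1 (mem_insert_self v W))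
  refine ⟨h_disj, ?_⟩
  rw [disjUnion_eq_union, union_comm, ← powersetCard_succ_insert (notMem_erase v s),
    insert_erase hv]

lemma injOn_insert_powersetCard_erase (s : Finset α) (v : α) (k : ℕ) :
    Set.InjOn (insert v) ((s.erase v).powersetCard k : Set (Finset α)) := by
  intro V hV W hW hVW
  have hv (A : Finset α) (hA : A ∈ (s.erase v).powersetCard k) : v ∉ A :=
    fun h => notMem_erase v s ((mem_powersetCard.1 hA).1 h)
  rw [← erase_insert (hv V hV), hVW, erase_insert (hv W hW)]

lemma sum_erase_powersetCard (s : Finset α) (k : ℕ) (F : α → Finset α → ℝ) :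
    ∑ v ∈ s, ∑ W ∈ (s.erase v).powersetCard k, F v W
      = ∑ W ∈ s.powersetCard k, ∑ v ∈ s \ W, F v W := by
  refine sum_comm' fun v W => ?_
  simp only [mem_powersetCard, mem_sdiff, subset_erase]
  tauto

lemma sum_powersetCard_insert (s : Finset α) (k : ℕ) (F : α → Finset α → ℝ) :
    ∑ W ∈ s.powersetCard k, ∑ v ∈ s \ W, F v (insert v W)
      = ∑ V ∈ s.powersetCard (k + 1), ∑ v ∈ V, F v V := by
  rw [sum_sigma', sum_sigma']
  refine sum_bij' (fun p _ => ⟨insert p.2 p.1, p.2⟩) (fun p _ => ⟨p.1.erase p.2, p.2⟩)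
    ?_ ?_ ?_ ?_ fun _ _ => rfl
  all_goals
    rintro ⟨W, v⟩ h
    simp only [mem_sigma, mem_powersetCard, mem_sdiff] at h ⊢
  · obtain ⟨⟨hW, rfl⟩, hv, hvW⟩ := h
    exact ⟨⟨insert_subset hv hW, card_insert_of_notMem hvW⟩, mem_insert_self _ _⟩
  · obtain ⟨⟨hW, hcard⟩, hv⟩ := h
    refine ⟨⟨(erase_subset _ _).trans hW, ?_⟩, hW hv, notMem_erase _ _⟩
    rw [card_erase_of_mem hv, hcard, Nat.add_sub_cancel]
  · rw [erase_insert h.2.2]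
  · rw [insert_erase h.2]

lemma sum_erase_powersetCard_insert (s : Finset α) (k : ℕ) (F : α → Finset α → ℝ) :
    ∑ v ∈ s, ∑ W ∈ (s.erase v).powersetCard k, F v (insert v W)
      = ∑ V ∈ s.powersetCard (k + 1), ∑ v ∈ V, F v V := by
  rw [sum_erase_powersetCard s k fun v W => F v (insert v W), sum_powersetCard_insert]

lemma sum_sum_erase (s : Finset α) (g : α → ℝ) :
    ∑ v ∈ s, ∑ a ∈ s.erase v, g a = (#s - 1) * ∑ a ∈ s, g a := by
  rw [sum_congr rfl fun v hv => eq_sub_of_add_eq (sum_erase_add s g hv), sum_sub_distrib,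
    sum_const, nsmul_eq_mul]
  ring

lemma expect_powersetCard_expect_sdiff {s : Finset α} {k : ℕ} (hk : k ≤ #s)
    (F : Finset α → α → ℝ) :
    𝔼 W ∈ s.powersetCard k, 𝔼 b ∈ s \ W, F W b
      = (∑ W ∈ s.powersetCard k, ∑ b ∈ s \ W, F W b) / (#(s.powersetCard k) * (#s - k)) := by
  have h_inner : ∀ W ∈ s.powersetCard k, 𝔼 b ∈ s \ W, F W b = (∑ b ∈ s \ W, F W b) / (#s - k) := by
    intro W hW
    obtain ⟨hWs, rfl⟩ := mem_powersetCard.1 hW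
    rw [expect_eq_sum_div_card, card_sdiff_of_subset hWs, Nat.cast_sub hk]
  rw [expect_congr rfl h_inner, expect_eq_sum_div_card, ← sum_div, div_div, mul_comm (_ - _)]

lemma expect_powersetCard_insert {s : Finset α} {k : ℕ} (hk : k ≤ #s) (f : Finset α → ℝ) :
    𝔼 W ∈ s.powersetCard k, 𝔼 b ∈ s \ W, f (insert b W) = 𝔼 V ∈ s.powersetCard (k + 1), f V := by
  have h_sum : ∑ W ∈ s.powersetCard k, ∑ b ∈ s \ W, f (insert b W)
      = (∑ V ∈ s.powersetCard (k + 1), f V) * (k + 1) := by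
    rw [sum_powersetCard_insert s k fun _ V => f V, sum_mul]
    refine sum_congr rfl fun V hV => ?_
    rw [sum_const, (mem_powersetCard.1 hV).2, nsmul_eq_mul, Nat.cast_add_one, mul_comm]
  rw [expect_powersetCard_expect_sdiff hk, h_sum, ← card_powersetCard_succ_mul hk,
    mul_div_mul_right _ _ (by positivity), expect_eq_sum_div_card]

lemma logDiff_expect_powersetCard_le {s : Finset α} {k : ℕ} (hk : k < #s)
    {f g : Finset α → ℝ} (hf : ∀ W, 0 < f W) (hg : ∀ W, 0 < g W) :
    logDiff (𝔼 W ∈ s.powersetCard k, g W) (𝔼 W ∈ s.powersetCard (k + 1), f W)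
      ≤ (∑ W ∈ s.powersetCard k, ∑ b ∈ s \ W, logDiff (g W) (f (insert b W)))
        / (#(s.powersetCard k) * (#s - k)) := by
  have h_sdiff : ∀ W ∈ s.powersetCard k, (s \ W).Nonempty := by
    intro W hW
    obtain ⟨hWs, rfl⟩ := mem_powersetCard.1 hW
    exact sdiff_nonempty.2 fun h => hk.ne (congrArg card (hWs.antisymm h))
  rw [← expect_powersetCard_insert hk.le, ← expect_powersetCard_expect_sdiff hk.le]
  refine (logDiff_expect_le (powersetCard_nonempty.2 hk.le) (fun W _ => hg W)
    fun W hW => expect_pos (fun b _ => hf _) (h_sdiff W hW)).trans (expect_le_expect fun W hW => ?_)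
  conv_lhs => rw [← expect_const (h_sdiff W hW) (g W)]
  exact logDiff_expect_le (h_sdiff W hW) (fun _ _ => hg W) fun b _ => hf _

lemma ent_powersetCard_succ_le {s : Finset α} {v : α} (hv : v ∈ s) {k : ℕ} (hk : k + 1 < #s)
    {f : Finset α → ℝ} (hf : ∀ W, 0 < f W) :
    ent (s.powersetCard (k + 1)) f
      ≤ ent ((s.erase v).powersetCard k) (fun W => f (insert v W))
        + ent ((s.erase v).powersetCard (k + 1)) f
        + (∑ W ∈ (s.erase v).powersetCard k, ∑ b ∈ s.erase v \ W,
            logDiff (f (insert v W)) (f (insert b W))) / #s := by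
  obtain ⟨h_disj, h_split⟩ := powersetCard_succ_eq_disjUnion hv k
  have h_inj := injOn_insert_powersetCard_erase s v k
  have h_card : (#s : ℝ) = #(s.erase v) + 1 := by exact_mod_cast (card_erase_add_one hv).symm
  have hk' : k < #(s.erase v) := by rwa [← add_lt_add_iff_right 1, card_erase_add_one hv]
  have h_union := ent_disjUnion_le h_disj ((powersetCard_nonempty.2 hk'.le).image _)
    (powersetCard_nonempty.2 hk') hf
  have h_image : ent (((s.erase v).powersetCard k).image (insert v)) f
      = ent ((s.erase v).powersetCard k) fun W => f (insert v W) := by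
    simp only [ent, sum_image h_inj, expect_image h_inj]
  rw [← h_split, h_image, card_image_of_injOn h_inj, expect_image h_inj] at h_union
  refine h_union.trans (add_le_add_right ?_ _)
  refine (mul_le_mul_of_nonneg_left (logDiff_expect_powersetCard_le hk' hf fun W => hf _)
    (by positivity)).trans_eq ?_
  rw [mul_div_left_comm, card_powersetCard_mul_div_add hk', h_card, mul_one_div]

lemma sum_exchangeSum_erase_insert (s : Finset α) (k : ℕ) (H : Finset α → α → α → ℝ) :
    ∑ v ∈ s, exchangeSum (s.erase v) k (fun W a b => H (insert v W) a b)
      = k * exchangeSum s (k + 1) H := by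
  have h_rewrite : ∀ v ∈ s, exchangeSum (s.erase v) k (fun W a b => H (insert v W) a b)
      = ∑ W ∈ (s.erase v).powersetCard k,
          ∑ a ∈ (insert v W).erase v, ∑ b ∈ s \ insert v W, H (insert v W) a b := by
    refine fun v _ => sum_congr rfl fun W hW => ?_
    have hv : v ∉ W := fun h => notMem_erase v s ((mem_powersetCard.1 hW).1 h)
    rw [erase_insert hv, sdiff_insert, erase_sdiff_comm]
  rw [sum_congr rfl h_rewrite, sum_erase_powersetCard_insert s k
    fun v V => ∑ a ∈ V.erase v, ∑ b ∈ s \ V, H V a b, exchangeSum, mul_sum]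
  refine sum_congr rfl fun V hV => ?_
  rw [sum_sum_erase, (mem_powersetCard.1 hV).2, Nat.cast_add_one, add_sub_cancel_right]

lemma sum_exchangeSum_erase {s : Finset α} {k : ℕ} (hk : k ≤ #s)
    (H : Finset α → α → α → ℝ) :
    ∑ v ∈ s, exchangeSum (s.erase v) k H = (#s - k - 1) * exchangeSum s k H := by
  simp only [exchangeSum, erase_sdiff_comm]
  rw [sum_erase_powersetCard s k fun v W => ∑ a ∈ W, ∑ b ∈ (s \ W).erase v, H W a b, mul_sum]
  refine sum_congr rfl fun W hW => ?_
  obtain ⟨hWs, rfl⟩ := mem_powersetCard.1 hW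
  rw [sum_comm, mul_sum]
  refine sum_congr rfl fun a _ => ?_
  rw [sum_sum_erase, card_sdiff_of_subset hWs, Nat.cast_sub hk]

/-- The Dirichlet form `∑ (f W - f W') (log f W - log f W')` of the exchange walk on the
`k`-subsets of `s`, the sum being over all moves `W → W'`. -/
noncomputable def dirichlet (s : Finset α) (k : ℕ) (f : Finset α → ℝ) : ℝ :=
  exchangeSum s k fun W a b => logDiff (f W) (f (exchange W a b))

lemma dirichlet_nonneg (s : Finset α) (k : ℕ) {f : Finset α → ℝ} (hf : ∀ W, 0 < f W) :
    0 ≤ dirichlet s k f :=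
  sum_nonneg fun _ _ => sum_nonneg fun _ _ => sum_nonneg fun _ _ => logDiff_nonneg (hf _) (hf _)

lemma exchange_insert {W : Finset α} {v a : α} (h : v ≠ a) (b : α) :
    exchange (insert v W) a b = insert v (exchange W a b) := by
  rw [exchange, exchange, erase_insert_of_ne h, insert_comm]

lemma sum_dirichlet_erase {s : Finset α} {k : ℕ} (hk : k + 1 ≤ #s)
    (f : Finset α → ℝ) :
    ∑ v ∈ s, (dirichlet (s.erase v) k (fun W => f (insert v W)) + dirichlet (s.erase v) (k + 1) f)
      = (#s - 2) * dirichlet s (k + 1) f := by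
  have h_rewrite : ∀ v ∈ s, dirichlet (s.erase v) k (fun W => f (insert v W))
      = exchangeSum (s.erase v) k fun W a b =>
          logDiff (f (insert v W)) (f (exchange (insert v W) a b)) := by
    refine fun v _ => sum_congr rfl fun W hW => sum_congr rfl fun a ha => ?_
    have hva : v ≠ a := fun h => notMem_erase v s (h ▸ (mem_powersetCard.1 hW).1 ha)
    simp only [exchange_insert hva]
  rw [sum_add_distrib, sum_congr rfl h_rewrite, sum_exchangeSum_erase_insert s k
    fun V a b => logDiff (f V) (f (exchange V a b))]
  simp only [dirichlet]
  rw [sum_exchangeSum_erase hk]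
  push_cast
  ring

lemma sum_link_eq_dirichlet (s : Finset α) (k : ℕ) (f : Finset α → ℝ) :
    ∑ v ∈ s, ∑ W ∈ (s.erase v).powersetCard k, ∑ b ∈ s.erase v \ W,
        logDiff (f (insert v W)) (f (insert b W)) = dirichlet s (k + 1) f := by
  rw [dirichlet, exchangeSum, ← sum_erase_powersetCard_insert s k
    fun v V => ∑ b ∈ s \ V, logDiff (f V) (f (exchange V v b))]
  refine sum_congr rfl fun v _ => sum_congr rfl fun W hW => ?_
  have hv : v ∉ W := fun h => notMem_erase v s ((mem_powersetCard.1 hW).1 h)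
  simp only [exchange, erase_insert hv, sdiff_insert, erase_sdiff_comm]

lemma modified_log_sobolev_of_erase {s : Finset α} {k : ℕ} (hk : k + 1 < #s)
    {f : Finset α → ℝ} (hf : ∀ W, 0 < f W)
    (h_erase : ∀ v ∈ s, ∀ (j : ℕ) (g : Finset α → ℝ), (∀ W, 0 < g W) →
      (#s - 1) * ent ((s.erase v).powersetCard j) g ≤ dirichlet (s.erase v) j g) :
    #s * ent (s.powersetCard (k + 1)) f ≤ dirichlet s (k + 1) f := by
  have h_card : (1 : ℝ) < #s := by exact_mod_cast (Nat.le_add_left 1 k).trans_lt hk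
  set E := ent (s.powersetCard (k + 1)) f
  set D := dirichlet s (k + 1) f
  have hD : 0 ≤ D := dirichlet_nonneg s (k + 1) hf
  have h_split : ∀ v ∈ s, (#s - 1) * E
      ≤ (dirichlet (s.erase v) k (fun W => f (insert v W)) + dirichlet (s.erase v) (k + 1) f)
        + (#s - 1) / #s * ∑ W ∈ (s.erase v).powersetCard k, ∑ b ∈ s.erase v \ W,
            logDiff (f (insert v W)) (f (insert b W)) := by
    intro v hv
    have h_insert := h_erase v hv k (fun W => f (insert v W)) fun _ => hf _
    have h_avoid := h_erase v hv (k + 1) f hf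
    have h := mul_le_mul_of_nonneg_left (ent_powersetCard_succ_le hv hk hf) (sub_pos.2 h_card).le
    rw [mul_add, mul_add, mul_div_left_comm, mul_comm (Finset.sum _ _)] at h
    linarith
  -- The parts with and without `v` contribute `#s - 2` copies of `D`, the passage between them
  -- `(#s - 1) / #s ≤ 1` more, and `#s - 1` are available.
  have h_sum := sum_le_sum h_split
  rw [sum_const, nsmul_eq_mul, sum_add_distrib, sum_dirichlet_erase hk.le, ← mul_sum,
    sum_link_eq_dirichlet] at h_sum
  have h_coeff : (#s - 2) * D + (#s - 1) / #s * D ≤ (#s - 1) * D := by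
    rw [← add_mul]
    gcongr
    linarith [(div_le_one (by linarith)).2 (show (#s : ℝ) - 1 ≤ #s by linarith)]
  exact le_of_mul_le_mul_left (by linarith) (sub_pos.2 h_card)

lemma modified_log_sobolev (s : Finset α) (k : ℕ) {f : Finset α → ℝ} (hf : ∀ W, 0 < f W) :
    #s * ent (s.powersetCard k) f ≤ dirichlet s k f := by
  induction hn : #s generalizing s k f with
  | zero => simpa using dirichlet_nonneg s k hf
  | succ n ih =>
    rw [← hn]
    have h_trivial (h : #(s.powersetCard k) ≤ 1) :
        #s * ent (s.powersetCard k) f ≤ dirichlet s k f := by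
      simpa [ent_eq_zero_of_card_le_one h] using dirichlet_nonneg s k hf
    rcases k with - | k
    · exact h_trivial (by simp)
    rcases le_or_gt #s (k + 1) with hk | hk
    · exact h_trivial (card_powersetCard_le_one hk)
    refine modified_log_sobolev_of_erase hk hf fun v hv j g hg => ?_
    have h := ih (s.erase v) j hg (by rw [card_erase_of_mem hv, hn, Nat.add_sub_cancel])
    rwa [hn, Nat.cast_add_one, add_sub_cancel_right]

end Slice

/-! ### Herbst's argument -/

section Herbst

lemma hasDerivAt_dslope_zero {φ : ℝ → ℝ} (h_zero : φ 0 = 0) {φ' x : ℝ} (hx : x ≠ 0)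
    (h : HasDerivAt φ φ' x) : HasDerivAt (dslope φ 0) ((φ' * x - φ x) / x ^ 2) x := by
  have h_div := h.div (hasDerivAt_id x) hx
  simp only [id_eq, mul_one] at h_div
  refine h_div.congr_of_eventuallyEq ?_
  filter_upwards [eventually_ne_nhds hx] with y hy
  simp [dslope_of_ne _ hy, slope_def_field, h_zero]

lemma le_of_mul_deriv_sub_le {φ φ' : ℝ → ℝ} (h_deriv : ∀ l, HasDerivAt φ (φ' l) l)
    (h_zero : φ 0 = 0) {c : ℝ} (h_le : ∀ l, 0 < l → l * φ' l - φ l ≤ c * l ^ 2) {l : ℝ}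
    (hl : 0 < l) : φ l ≤ l * φ' 0 + c * l ^ 2 := by
  have h_slope_deriv (x : ℝ) (hx : 0 < x) := hasDerivAt_dslope_zero h_zero hx.ne' (h_deriv x)
  have h_cont : ContinuousOn (dslope φ 0) (Set.Icc 0 l) := by
    intro x hx
    rcases hx.1.eq_or_lt with rfl | hx
    · exact (continuousAt_dslope_same.2 (h_deriv 0).differentiableAt).continuousWithinAt
    · exact (h_slope_deriv x hx).continuousAt.continuousWithinAt
  have h_mean := (convex_Icc 0 l).image_sub_le_mul_sub_of_deriv_le (C := c) h_cont
    (fun x hx => ?_) (fun x hx => ?_) 0 ⟨le_rfl, hl.le⟩ l ⟨hl.le, le_rfl⟩ hl.le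
  · rw [dslope_same, (h_deriv 0).deriv, dslope_of_ne _ hl.ne', slope_def_field, h_zero, sub_zero,
      sub_zero, sub_le_iff_le_add, div_le_iff₀ hl] at h_mean
    linarith
  all_goals rw [interior_Icc] at hx
  · exact (h_slope_deriv x hx.1).differentiableAt.differentiableWithinAt
  · rw [(h_slope_deriv x hx.1).deriv, div_le_iff₀ (pow_pos hx.1 2), mul_comm]
    exact h_le x hx.1

variable {ι : Type*} {P : Finset ι}

lemma hasDerivAt_expect_exp_mul (P : Finset ι) (Z : ι → ℝ) (l : ℝ) :
    HasDerivAt (fun l => 𝔼 i ∈ P, Real.exp (l * Z i)) (𝔼 i ∈ P, Real.exp (l * Z i) * Z i) l := by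
  simp only [expect_eq_sum_div_card]
  refine (HasDerivAt.fun_sum fun i _ => ?_).div_const _
  simpa using ((hasDerivAt_id l).mul_const (Z i)).exp

lemma ent_exp_mul (P : Finset ι) (Z : ι → ℝ) (l : ℝ) :
    ent P (fun i => Real.exp (l * Z i))
      = #P * (l * 𝔼 i ∈ P, Real.exp (l * Z i) * Z i
        - (𝔼 i ∈ P, Real.exp (l * Z i)) * Real.log (𝔼 i ∈ P, Real.exp (l * Z i))) := by
  rw [mul_sub, mul_left_comm, card_mul_expect, ← mul_assoc, card_mul_expect, ent, mul_sum]
  simp only [Real.log_exp, mul_left_comm]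

lemma expect_exp_le_of_ent_le (hP : P.Nonempty) {Z : ι → ℝ} {c : ℝ}
    (h_ent : ∀ l, 0 < l → ent P (fun i => Real.exp (l * Z i))
      ≤ c * l ^ 2 * ∑ i ∈ P, Real.exp (l * Z i)) {l : ℝ} (hl : 0 < l) :
    𝔼 i ∈ P, Real.exp (l * Z i) ≤ Real.exp (l * 𝔼 i ∈ P, Z i + c * l ^ 2) := by
  have h_card : (0 : ℝ) < #P := by exact_mod_cast hP.card_pos
  have h_pos (l : ℝ) : 0 < 𝔼 i ∈ P, Real.exp (l * Z i) :=
    expect_pos (fun _ _ => Real.exp_pos _) hP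
  rw [← Real.log_le_iff_le_exp (h_pos l)]
  have h_le (l : ℝ) (hl : 0 < l) :
      l * ((𝔼 i ∈ P, Real.exp (l * Z i) * Z i) / 𝔼 i ∈ P, Real.exp (l * Z i))
        - Real.log (𝔼 i ∈ P, Real.exp (l * Z i)) ≤ c * l ^ 2 := by
    have h := h_ent l hl
    rw [ent_exp_mul, ← card_mul_expect, mul_left_comm, mul_le_mul_iff_right₀ h_card] at h
    rw [← mul_div_assoc, div_sub' (h_pos l).ne', div_le_iff₀ (h_pos l)]
    exact h
  have h := le_of_mul_deriv_sub_le
    (fun l => (hasDerivAt_expect_exp_mul P Z l).log (h_pos l).ne') (by simp [hP]) h_le hl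
  simpa [hP] using h

lemma card_expect_add_le_le (hP : P.Nonempty) {Z : ι → ℝ} {c : ℝ} (hc : 0 < c)
    (h_ent : ∀ l, 0 < l → ent P (fun i => Real.exp (l * Z i))
      ≤ c * l ^ 2 * ∑ i ∈ P, Real.exp (l * Z i)) {t : ℝ} (ht : 0 < t) :
    (#{i ∈ P | 𝔼 j ∈ P, Z j + t ≤ Z i} : ℝ) ≤ Real.exp (-(t ^ 2 / (4 * c))) * #P := by
  set μ := 𝔼 j ∈ P, Z j
  obtain ⟨l, rfl⟩ : ∃ l, t = 2 * c * l := ⟨t / (2 * c), by field_simp⟩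
  have hl : 0 < l := pos_of_mul_pos_right ht (by positivity)
  have h_markov : #{i ∈ P | μ + 2 * c * l ≤ Z i} * Real.exp (l * (μ + 2 * c * l))
      ≤ ∑ i ∈ P, Real.exp (l * Z i) := by
    rw [← nsmul_eq_mul]
    refine (card_nsmul_le_sum _ _ _ fun i hi => ?_).trans
      (sum_le_sum_of_subset_of_nonneg (filter_subset _ P) fun _ _ _ => (Real.exp_pos _).le)
    exact Real.exp_le_exp.2 (mul_le_mul_of_nonneg_left (mem_filter.1 hi).2 hl.le)
  have h_mgf := mul_le_mul_of_nonneg_left (expect_exp_le_of_ent_le hP h_ent hl)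
    (Nat.cast_nonneg (α := ℝ) #P)
  rw [card_mul_expect] at h_mgf
  have h_exponent : Real.exp (l * μ + c * l ^ 2)
      = Real.exp (-((2 * c * l) ^ 2 / (4 * c))) * Real.exp (l * (μ + 2 * c * l)) := by
    rw [← Real.exp_add]
    congr 1
    field_simp
    ring
  rw [h_exponent, mul_left_comm, ← mul_assoc] at h_mgf
  exact le_of_mul_le_mul_right (h_markov.trans h_mgf) (Real.exp_pos _)

end Herbst

/-! ### Concentration for functions of a uniform random subset -/

section Concentration

variable {α : Type*} [DecidableEq α] {s W : Finset α} {k : ℕ}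

lemma exchange_mem_powersetCard {a b : α} (hW : W ∈ s.powersetCard k) (ha : a ∈ W)
    (hb : b ∈ s \ W) : exchange W a b ∈ s.powersetCard k := by
  rw [mem_powersetCard] at hW ⊢
  rw [mem_sdiff] at hb
  refine ⟨insert_subset hb.1 ((erase_subset _ _).trans hW.1), ?_⟩
  rw [exchange, card_insert_of_notMem fun h => hb.2 (mem_of_mem_erase h),
    card_erase_add_one ha, hW.2]

lemma exchange_exchange {a b : α} (ha : a ∈ W) (hb : b ∉ W) :
    exchange (exchange W a b) b a = W := by
  rw [exchange, exchange, erase_insert fun h => hb (mem_of_mem_erase h), insert_erase ha]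

lemma exchangeSum_symm (s : Finset α) (k : ℕ) (H : Finset α → Finset α → ℝ) :
    exchangeSum s k (fun W a b => H (exchange W a b) W)
      = exchangeSum s k fun W a b => H W (exchange W a b) := by
  simp only [exchangeSum, ← sum_product']
  rw [sum_sigma', sum_sigma']
  let flip : (Σ _ : Finset α, α × α) → Σ _ : Finset α, α × α :=
    fun p => ⟨exchange p.1 p.2.1 p.2.2, p.2.2, p.2.1⟩
  have h_maps : ∀ p ∈ (s.powersetCard k).sigma fun W => W ×ˢ (s \ W),
      flip p ∈ (s.powersetCard k).sigma fun W => W ×ˢ (s \ W) := by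
    rintro ⟨W, a, b⟩ h
    simp only [mem_sigma, mem_product] at h
    simp only [flip, mem_sigma, mem_product]
    refine ⟨exchange_mem_powersetCard h.1 h.2.1 h.2.2, mem_insert_self _ _, ?_⟩
    have hab : a ≠ b := fun hab => (mem_sdiff.1 h.2.2).2 (hab ▸ h.2.1)
    simp [exchange, hab, (mem_powersetCard.1 h.1).1 h.2.1]
  have h_flip : ∀ p ∈ (s.powersetCard k).sigma fun W => W ×ˢ (s \ W), flip (flip p) = p := by
    rintro ⟨W, a, b⟩ h
    simp only [mem_sigma, mem_product, mem_sdiff] at h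
    simp only [flip, exchange_exchange h.2.1 h.2.2.2]
  refine sum_bij' (fun p _ => flip p) (fun p _ => flip p) h_maps h_maps h_flip h_flip ?_
  rintro ⟨W, a, b⟩ h
  simp only [mem_sigma, mem_product, mem_sdiff] at h
  simp only [flip, exchange_exchange h.2.1 h.2.2.2]

/-- The sum of the squared decreases of `Z` under the exchanges of an element of `W` for an element
of `s` outside `W`; it controls the upper tail of `Z`. -/
def downVar (s : Finset α) (Z : Finset α → ℝ) (W : Finset α) : ℝ :=
  ∑ a ∈ W, ∑ b ∈ s \ W, (Z W - Z (exchange W a b))⁺ ^ 2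

lemma card_mul_ent_exp_le (s : Finset α) (k : ℕ) (Z : Finset α → ℝ) {l : ℝ} (hl : 0 < l) :
    #s * ent (s.powersetCard k) (fun W => Real.exp (l * Z W))
      ≤ 2 * l ^ 2 * ∑ W ∈ s.powersetCard k, Real.exp (l * Z W) * downVar s Z W := by
  set H : Finset α → Finset α → ℝ := fun W V => l ^ 2 * (Real.exp (l * Z W) * (Z W - Z V)⁺ ^ 2)
  have h_logDiff (W V : Finset α) :
      logDiff (Real.exp (l * Z W)) (Real.exp (l * Z V)) ≤ H W V + H V W := by
    have h_scale (x y : ℝ) : (l * x - l * y)⁺ = l * (x - y)⁺ := by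
      rw [← mul_sub, posPart_def, posPart_def, ← mul_zero l, ← mul_max_of_nonneg _ _ hl.le,
        mul_zero]
    refine (logDiff_exp_le _ _).trans_eq ?_
    rw [h_scale, h_scale]
    ring
  calc #s * ent (s.powersetCard k) (fun W => Real.exp (l * Z W))
      ≤ exchangeSum s k fun W a b => H W (exchange W a b) + H (exchange W a b) W :=
        (modified_log_sobolev s k fun _ => Real.exp_pos _).trans <| sum_le_sum fun W _ =>
          sum_le_sum fun a _ => sum_le_sum fun b _ => h_logDiff W (exchange W a b)
    _ = 2 * exchangeSum s k fun W a b => H W (exchange W a b) := by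
        rw [two_mul]
        nth_rewrite 2 [← exchangeSum_symm s k H]
        simp only [exchangeSum, sum_add_distrib]
    _ = 2 * l ^ 2 * ∑ W ∈ s.powersetCard k, Real.exp (l * Z W) * downVar s Z W := by
        simp only [exchangeSum, H, downVar, ← mul_sum, mul_assoc]

lemma card_expect_add_le_of_downVar_le (hs : s.Nonempty) (hk : k ≤ #s) {Z : Finset α → ℝ} {c : ℝ}
    (hc : 0 < c) (hZ : ∀ W ∈ s.powersetCard k, downVar s Z W ≤ c * #s) {t : ℝ} (ht : 0 < t) :
    (#{W ∈ s.powersetCard k | 𝔼 V ∈ s.powersetCard k, Z V + t ≤ Z W} : ℝ)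
      ≤ Real.exp (-(t ^ 2 / (8 * c))) * #(s.powersetCard k) := by
  have h_card : (0 : ℝ) < #s := by exact_mod_cast hs.card_pos
  have h := card_expect_add_le_le (c := 2 * c) (powersetCard_nonempty.2 hk) (Z := Z) (by positivity)
    (fun l hl => ?_) ht
  · convert h using 4
    ring
  refine le_of_mul_le_mul_left ((card_mul_ent_exp_le s k Z hl).trans ?_) h_card
  calc 2 * l ^ 2 * ∑ W ∈ s.powersetCard k, Real.exp (l * Z W) * downVar s Z W
      ≤ 2 * l ^ 2 * ∑ W ∈ s.powersetCard k, Real.exp (l * Z W) * (c * #s) := by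
        gcongr with W hW
        exact hZ W hW
    _ = #s * (2 * c * l ^ 2 * ∑ W ∈ s.powersetCard k, Real.exp (l * Z W)) := by
        rw [← sum_mul]
        ring

omit [DecidableEq α] in
lemma posPart_sqrt_sub_sqrt_sq_mul_le {x : ℝ} (hx : 0 ≤ x) (y : ℝ) :
    (√x - √y)⁺ ^ 2 * x ≤ (x - y)⁺ ^ 2 := by
  have h_sqrt : (√x - √y)⁺ * √x ≤ (x - y)⁺ := by
    rcases le_total √x √y with h | h
    · rw [posPart_of_nonpos (sub_nonpos.2 h), zero_mul]
      exact posPart_nonneg _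
    · rw [posPart_of_nonneg (sub_nonneg.2 h)]
      refine le_trans ?_ (le_posPart _)
      have h_le : y ≤ √y * √x := by
        rcases le_total y 0 with hy | hy
        · exact hy.trans (by positivity)
        · exact (Real.mul_self_sqrt hy).ge.trans (mul_le_mul_of_nonneg_left h (Real.sqrt_nonneg y))
      linarith [Real.mul_self_sqrt hx]
  calc (√x - √y)⁺ ^ 2 * x = ((√x - √y)⁺ * √x) ^ 2 := by rw [mul_pow, Real.sq_sqrt hx]
    _ ≤ (x - y)⁺ ^ 2 :=
        pow_le_pow_left₀ (mul_nonneg (posPart_nonneg _) (Real.sqrt_nonneg x)) h_sqrt 2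

lemma downVar_sqrt_mul_le (s : Finset α) {Z : Finset α → ℝ} (hZ : 0 ≤ Z W) :
    downVar s (fun V => √(Z V)) W * Z W ≤ downVar s Z W := by
  simp only [downVar, sum_mul]
  exact sum_le_sum fun a _ => sum_le_sum fun b _ => posPart_sqrt_sub_sqrt_sq_mul_le hZ _

omit [DecidableEq α] in
lemma sq_expect_le_expect_sq {ι : Type*} {P : Finset ι} (hP : P.Nonempty) (f : ι → ℝ) :
    (𝔼 i ∈ P, f i) ^ 2 ≤ 𝔼 i ∈ P, f i ^ 2 := by
  simpa [hP] using expect_mul_sq_le_sq_mul_sq P f 1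

lemma card_two_mul_expect_add_lt_le (hs : s.Nonempty) (hk : k ≤ #s) {Z : Finset α → ℝ}
    (hZ : ∀ W ∈ s.powersetCard k, 0 < Z W) {c : ℝ} (hc : 0 < c)
    (hdown : ∀ W ∈ s.powersetCard k, downVar s Z W ≤ c * #s * Z W) {x : ℝ} (hx : 0 < x) :
    (#{W ∈ s.powersetCard k | 2 * 𝔼 V ∈ s.powersetCard k, Z V + 16 * c * x < Z W} : ℝ)
      ≤ Real.exp (-x) * #(s.powersetCard k) := by
  set t := √(8 * c * x)
  have ht_sq : t ^ 2 = 8 * c * x := Real.sq_sqrt (by positivity)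
  have h_tail := card_expect_add_le_of_downVar_le hs hk (Z := fun W => √(Z W)) hc
    (fun W hW => le_of_mul_le_mul_right
      ((downVar_sqrt_mul_le s (hZ W hW).le).trans (hdown W hW)) (hZ W hW))
    (show 0 < t by positivity)
  have h_rate : t ^ 2 / (8 * c) = x := by
    rw [ht_sq, mul_div_cancel_left₀ _ (by positivity)]
  rw [h_rate] at h_tail
  refine le_trans (Nat.cast_le.2 (card_le_card (monotone_filter_right _ fun W _ h => ?_))) h_tail
  have h_mean : (𝔼 V ∈ s.powersetCard k, √(Z V)) ^ 2 ≤ 𝔼 V ∈ s.powersetCard k, Z V :=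
    (sq_expect_le_expect_sq (powersetCard_nonempty.2 hk) _).trans_eq
      (expect_congr rfl fun V hV => Real.sq_sqrt (hZ V hV).le)
  by_contra! h_lt
  have h_sq := (Real.sqrt_lt' (by linarith [Real.sqrt_nonneg (Z W)])).1 h_lt
  linarith [add_sq_le (a := 𝔼 V ∈ s.powersetCard k, √(Z V)) (b := t)]

end Concentration

/-! ### Suprema of deviations of sample averages -/

section Suprema

variable {α ι : Type*} {s W : Finset α} {k : ℕ}

/-- The deviation of the average of `v` over the subset `W` from its average over the whole set `s`,
the abstract form of `R⁺ h`. -/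
noncomputable def sampleDev (s W : Finset α) (v : α → ℝ) : ℝ :=
  𝔼 i ∈ W, v i - 𝔼 i ∈ s, v i

/-- The largest deviation of the sample averages over `W` of a family of functions. -/
noncomputable def supDev (s : Finset α) (w : ι → α → ℝ) (W : Finset α) : ℝ :=
  ⨆ j, sampleDev s W (w j)

/-- The largest second moment over `W` of a family of functions. -/
noncomputable def supSq (w : ι → α → ℝ) (W : Finset α) : ℝ :=
  ⨆ j, 𝔼 i ∈ W, w j i ^ 2

lemma nonempty_of_mem_powersetCard (hk : 1 ≤ k) (hW : W ∈ s.powersetCard k) : W.Nonempty :=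
  card_pos.1 ((mem_powersetCard.1 hW).2 ▸ hk)

lemma abs_expect_le_of_abs_le {v : α → ℝ} {L : ℝ} (hW : W.Nonempty) (hv : ∀ i ∈ W, |v i| ≤ L) :
    |𝔼 i ∈ W, v i| ≤ L :=
  (abs_expect_le W v).trans (expect_le hW hv)

lemma bddAbove_range_sampleDev {w : ι → α → ℝ} {L : ℝ} (hW : W.Nonempty) (hWs : W ⊆ s)
    (hL : ∀ j, ∀ i ∈ s, |w j i| ≤ L) : BddAbove (Set.range fun j => sampleDev s W (w j)) := by
  refine ⟨L + L, Set.forall_mem_range.2 fun j => ?_⟩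
  have h_sample := abs_expect_le_of_abs_le hW fun i hi => hL j i (hWs hi)
  have h_full := abs_expect_le_of_abs_le (hW.mono hWs) (hL j)
  exact sub_le_iff_le_add.2 (by linarith [le_of_abs_le h_sample, neg_le_of_abs_le h_full])

lemma abs_sq_apply_le {w : ι → α → ℝ} {L : ℝ} (hL : ∀ j, ∀ i ∈ s, |w j i| ≤ L) (j : ι) (i : α)
    (hi : i ∈ s) : |(w ^ 2) j i| ≤ L ^ 2 := by
  simpa [abs_pow] using pow_le_pow_left₀ (abs_nonneg _) (hL j i hi) 2

lemma bddAbove_range_expect_sq {w : ι → α → ℝ} {L : ℝ} (hW : W.Nonempty) (hWs : W ⊆ s)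
    (hL : ∀ j, ∀ i ∈ s, |w j i| ≤ L) : BddAbove (Set.range fun j => 𝔼 i ∈ W, w j i ^ 2) :=
  ⟨L ^ 2, Set.forall_mem_range.2 fun j =>
    expect_le hW fun i hi => (le_abs_self _).trans (abs_sq_apply_le hL j i (hWs hi))⟩

variable [DecidableEq α]

lemma expect_sub_expect_exchange {a b : α} (ha : a ∈ W) (hb : b ∉ W) (z : α → ℝ) :
    𝔼 i ∈ W, z i - 𝔼 i ∈ exchange W a b, z i = (z a - z b) / #W := by
  have hb' : b ∉ W.erase a := fun h => hb (mem_of_mem_erase h)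
  have h_card : #(exchange W a b) = #W := by
    rw [exchange, card_insert_of_notMem hb', card_erase_add_one ha]
  rw [expect_eq_sum_div_card, expect_eq_sum_div_card, h_card, ← sub_div, exchange,
    sum_insert hb', ← add_sum_erase W z ha]
  ring

lemma downVar_add_le (s : Finset α) (U V : Finset α → ℝ) (W : Finset α) :
    downVar s (U + V) W ≤ 2 * downVar s U W + 2 * downVar s V W := by
  simp only [downVar, mul_sum, ← sum_add_distrib]
  refine sum_le_sum fun a _ => sum_le_sum fun b _ => ?_
  rw [Pi.add_apply, Pi.add_apply, add_sub_add_comm]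
  refine (pow_le_pow_left₀ (posPart_nonneg _) (sup_le (add_le_add (le_posPart _) (le_posPart _))
    (add_nonneg (posPart_nonneg _) (posPart_nonneg _))) 2).trans ?_
  rw [← mul_add]
  exact add_sq_le

lemma downVar_const_mul (s : Finset α) {θ : ℝ} (hθ : 0 ≤ θ) (Z : Finset α → ℝ) (W : Finset α) :
    downVar s (fun V => θ * Z V) W = θ ^ 2 * downVar s Z W := by
  simp only [downVar, mul_sum, ← mul_pow]
  refine sum_congr rfl fun a _ => sum_congr rfl fun b _ => ?_
  rw [← mul_sub, posPart_def, posPart_def, mul_max_of_nonneg _ _ hθ, mul_zero]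

lemma downVar_const_add (s : Finset α) (c : ℝ) (Z : Finset α → ℝ) (W : Finset α) :
    downVar s (fun V => c + Z V) W = downVar s Z W := by
  simp only [downVar, add_sub_add_left_eq_sub]

lemma downVar_iSup_le [Nonempty ι] {g : ι → Finset α → ℝ}
    (hg : ∀ V ∈ s.powersetCard k, BddAbove (Set.range fun j => g j V))
    (hW : W ∈ s.powersetCard k) {M : ℝ} (hM : ∀ j, downVar s (g j) W ≤ M) :
    downVar s (fun V => ⨆ j, g j V) W ≤ M := by
  let T : Set ℝ := {t | ∑ a ∈ W, ∑ b ∈ s \ W, (t - ⨆ j, g j (exchange W a b))⁺ ^ 2 ≤ M}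
  have h_closed : IsClosed T := by
    simp only [T, posPart_def]
    exact isClosed_le (by fun_prop) continuous_const
  have h_subset : Set.range (fun j => g j W) ⊆ T := by
    refine Set.range_subset_iff.2 fun j => le_trans ?_ (hM j)
    refine sum_le_sum fun a ha => sum_le_sum fun b hb => pow_le_pow_left₀ (posPart_nonneg _) ?_ 2
    exact posPart_mono
      (sub_le_sub_left (le_ciSup (hg _ (exchange_mem_powersetCard hW ha hb)) j) _)
  exact closure_minimal h_subset h_closed (csSup_mem_closure (Set.range_nonempty _) (hg W hW))

lemma downVar_sampleDev_le (hW : W ∈ s.powersetCard k) (v : α → ℝ) :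
    downVar s (fun V => sampleDev s V v) W
      ≤ 2 * #s / k * (𝔼 i ∈ W, v i ^ 2 + 𝔼 i ∈ s, v i ^ 2) := by
  obtain ⟨-, rfl⟩ := mem_powersetCard.1 hW
  have h_term (a b : α) : ((v a - v b) / #W)⁺ ^ 2 ≤ 2 / #W ^ 2 * (v a ^ 2 + v b ^ 2) := by
    refine (pow_le_pow_left₀ (posPart_nonneg _) (sup_le (le_abs_self _) (abs_nonneg _)) 2).trans ?_
    rw [sq_abs, div_pow, div_mul_eq_mul_div]
    gcongr
    linarith [sq_nonneg (v a + v b)]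
  have h_sdiff : (#(s \ W) : ℝ) ≤ #s := by exact_mod_cast card_le_card sdiff_subset
  calc downVar s (fun V => sampleDev s V v) W
      = ∑ a ∈ W, ∑ b ∈ s \ W, ((v a - v b) / #W)⁺ ^ 2 := by
        simp only [downVar, sampleDev, sub_sub_sub_cancel_right]
        refine sum_congr rfl fun a ha => sum_congr rfl fun b hb => ?_
        rw [expect_sub_expect_exchange ha (mem_sdiff.1 hb).2]
    _ ≤ ∑ a ∈ W, ∑ b ∈ s \ W, 2 / #W ^ 2 * (v a ^ 2 + v b ^ 2) :=
        sum_le_sum fun a _ => sum_le_sum fun b _ => h_term a b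
    _ = 2 / #W ^ 2 * (#(s \ W) * ∑ a ∈ W, v a ^ 2 + #W * ∑ b ∈ s \ W, v b ^ 2) := by
        simp only [← mul_sum, sum_add_distrib, sum_const, nsmul_eq_mul]
    _ ≤ 2 / #W ^ 2 * (#s * ∑ a ∈ W, v a ^ 2 + #W * ∑ b ∈ s, v b ^ 2) := by
        gcongr
        exact sdiff_subset
    _ = 2 * #s / #W * (𝔼 i ∈ W, v i ^ 2 + 𝔼 i ∈ s, v i ^ 2) := by
        rw [← card_mul_expect W, ← card_mul_expect s]
        field_simp

lemma downVar_expect_sq_le (hW : W ∈ s.powersetCard k) {v : α → ℝ} {L : ℝ}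
    (hL : ∀ i ∈ s, |v i| ≤ L) :
    downVar s (fun V => 𝔼 i ∈ V, v i ^ 2) W ≤ L ^ 2 * #s / k * 𝔼 i ∈ W, v i ^ 2 := by
  obtain ⟨hWs, rfl⟩ := mem_powersetCard.1 hW
  have h_term (a b : α) (ha : a ∈ W) :
      ((v a ^ 2 - v b ^ 2) / #W)⁺ ^ 2 ≤ L ^ 2 / #W ^ 2 * v a ^ 2 := by
    have h_pos : ((v a ^ 2 - v b ^ 2) / #W)⁺ ≤ v a ^ 2 / #W := by
      refine sup_le ?_ (by positivity)
      gcongr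
      linarith [sq_nonneg (v b)]
    have h_sq : v a ^ 2 ≤ L ^ 2 := sq_le_sq.2 ((hL a (hWs ha)).trans (le_abs_self L))
    calc ((v a ^ 2 - v b ^ 2) / #W)⁺ ^ 2 ≤ (v a ^ 2 / #W) ^ 2 :=
          pow_le_pow_left₀ (posPart_nonneg _) h_pos 2
      _ = v a ^ 2 / #W ^ 2 * v a ^ 2 := by ring
      _ ≤ L ^ 2 / #W ^ 2 * v a ^ 2 := by gcongr
  have h_sdiff : (#(s \ W) : ℝ) ≤ #s := by exact_mod_cast card_le_card sdiff_subset
  calc downVar s (fun V => 𝔼 i ∈ V, v i ^ 2) W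
      = ∑ a ∈ W, ∑ b ∈ s \ W, ((v a ^ 2 - v b ^ 2) / #W)⁺ ^ 2 := by
        refine sum_congr rfl fun a ha => sum_congr rfl fun b hb => ?_
        rw [expect_sub_expect_exchange ha (mem_sdiff.1 hb).2]
    _ ≤ ∑ a ∈ W, ∑ _ ∈ s \ W, L ^ 2 / #W ^ 2 * v a ^ 2 :=
        sum_le_sum fun a ha => sum_le_sum fun _ _ => h_term a _ ha
    _ = #(s \ W) * (L ^ 2 / #W ^ 2 * ∑ a ∈ W, v a ^ 2) := by
        simp only [sum_const, nsmul_eq_mul, mul_sum]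
    _ ≤ #s * (L ^ 2 / #W ^ 2 * ∑ a ∈ W, v a ^ 2) := by gcongr
    _ = L ^ 2 * #s / #W * 𝔼 i ∈ W, v i ^ 2 := by
        rw [← card_mul_expect W]
        field_simp

section Family

variable {w : ι → α → ℝ} {L r θ : ℝ}

lemma downVar_supDev_le [Nonempty ι] (hk : 1 ≤ k) (hL : ∀ j, ∀ i ∈ s, |w j i| ≤ L)
    (hr : ∀ j, 𝔼 i ∈ s, w j i ^ 2 ≤ r) (hW : W ∈ s.powersetCard k) :
    downVar s (supDev s w) W ≤ 2 * #s / k * (supSq w W + r) := by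
  refine downVar_iSup_le (fun V hV => bddAbove_range_sampleDev (nonempty_of_mem_powersetCard hk hV)
    (mem_powersetCard.1 hV).1 hL) hW fun j => (downVar_sampleDev_le hW (w j)).trans ?_
  gcongr
  · exact le_ciSup (bddAbove_range_expect_sq (nonempty_of_mem_powersetCard hk hW)
      (mem_powersetCard.1 hW).1 hL) j
  · exact hr j

lemma downVar_supSq_le [Nonempty ι] (hk : 1 ≤ k) (hL : ∀ j, ∀ i ∈ s, |w j i| ≤ L)
    (hW : W ∈ s.powersetCard k) :
    downVar s (supSq w) W ≤ L ^ 2 * #s / k * supSq w W := by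
  have h_bdd (V : Finset α) (hV : V ∈ s.powersetCard k) :=
    bddAbove_range_expect_sq (nonempty_of_mem_powersetCard hk hV) (mem_powersetCard.1 hV).1 hL
  refine downVar_iSup_le h_bdd hW fun j => (downVar_expect_sq_le hW (hL j)).trans ?_
  gcongr
  exact le_ciSup (h_bdd W hW) j

omit [DecidableEq α] in
lemma supSq_nonneg (w : ι → α → ℝ) (W : Finset α) : 0 ≤ supSq w W :=
  Real.iSup_nonneg fun _ => expect_nonneg fun _ _ => sq_nonneg _

omit [DecidableEq α] in
lemma supDev_nonneg (hW : W.Nonempty) (hWs : W ⊆ s) (hL : ∀ j, ∀ i ∈ s, |w j i| ≤ L) {j₀ : ι}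
    (hj₀ : ∀ i ∈ s, w j₀ i = 0) : 0 ≤ supDev s w W := by
  have h_zero : sampleDev s W (w j₀) = 0 := by
    rw [sampleDev, expect_congr rfl fun i hi => hj₀ i (hWs hi), expect_congr rfl hj₀]
    simp
  exact h_zero.ge.trans (le_ciSup (bddAbove_range_sampleDev hW hWs hL) j₀)

omit [DecidableEq α] in
lemma supSq_le_supDev_add [Nonempty ι] (hW : W.Nonempty) (hWs : W ⊆ s)
    (hL : ∀ j, ∀ i ∈ s, |w j i| ≤ L) (hr : ∀ j, 𝔼 i ∈ s, w j i ^ 2 ≤ r) :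
    supSq w W ≤ supDev s (w ^ 2) W + r := by
  refine ciSup_le fun j => ?_
  have h_dev := le_ciSup (bddAbove_range_sampleDev hW hWs (abs_sq_apply_le hL)) j
  simp only [sampleDev, Pi.pow_apply] at h_dev
  rw [supDev]
  simp only [sampleDev, Pi.pow_apply]
  linarith [hr j]

lemma downVar_add_supDev_add_supSq_le (hk : 1 ≤ k) (hθ : 0 < θ)
    (hL : ∀ j, ∀ i ∈ s, |w j i| ≤ L) (hr : ∀ j, 𝔼 i ∈ s, w j i ^ 2 ≤ r) {j₀ : ι}
    (hj₀ : ∀ i ∈ s, w j₀ i = 0) (hW : W ∈ s.powersetCard k) :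
    downVar s (fun V => θ * r + (supDev s w V + θ * supSq w V)) W
      ≤ (4 + 2 * θ ^ 2 * L ^ 2) / (θ * k) * #s
        * (θ * r + (supDev s w W + θ * supSq w W)) := by
  have : Nonempty ι := ⟨j₀⟩
  have h_dev := supDev_nonneg (nonempty_of_mem_powersetCard hk hW) (mem_powersetCard.1 hW).1 hL hj₀
  have hr_nonneg : 0 ≤ r := (expect_nonneg fun i _ => sq_nonneg (w j₀ i)).trans (hr j₀)
  calc downVar s (fun V => θ * r + (supDev s w V + θ * supSq w V)) W
      ≤ 2 * downVar s (supDev s w) W + 2 * (θ ^ 2 * downVar s (supSq w) W) := by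
        rw [downVar_const_add, ← downVar_const_mul s hθ.le]
        exact downVar_add_le s _ _ W
    _ ≤ 2 * (2 * #s / k * (supSq w W + r)) + 2 * (θ ^ 2 * (L ^ 2 * #s / k * supSq w W)) := by
        gcongr
        · exact downVar_supDev_le hk hL hr hW
        · exact downVar_supSq_le hk hL hW
    _ = (4 * (supSq w W + r) + 2 * θ ^ 2 * L ^ 2 * supSq w W) * #s / k := by ring
    _ ≤ (4 + 2 * θ ^ 2 * L ^ 2) * (r + supSq w W) * #s / k := by
        gcongr
        nlinarith [mul_nonneg (mul_nonneg (sq_nonneg θ) (sq_nonneg L)) hr_nonneg]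
    _ ≤ (4 + 2 * θ ^ 2 * L ^ 2) * (r + (supSq w W + supDev s w W / θ)) * #s / k := by
        gcongr
        exact le_add_of_nonneg_right (by positivity)
    _ = (4 + 2 * θ ^ 2 * L ^ 2) / (θ * k) * #s
        * (θ * r + (supDev s w W + θ * supSq w W)) := by
        field_simp
        ring

omit [DecidableEq α] in
open scoped Classical in
lemma card_exists_lt_sampleDev_le (hk : 1 ≤ k) (hks : k ≤ #s) (hθ : 0 < θ) (hr_pos : 0 < r)
    (hL : ∀ j, ∀ i ∈ s, |w j i| ≤ L) (hr : ∀ j, 𝔼 i ∈ s, w j i ^ 2 ≤ r) {j₀ : ι}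
    (hj₀ : ∀ i ∈ s, w j₀ i = 0) {x : ℝ} (hx : 0 < x) :
    (#{W ∈ s.powersetCard k | ∃ j, 2 * 𝔼 V ∈ s.powersetCard k, supDev s w V
        + 2 * θ * 𝔼 V ∈ s.powersetCard k, supDev s (w ^ 2) V + 4 * θ * r
        + 16 * ((4 + 2 * θ ^ 2 * L ^ 2) / (θ * k)) * x < sampleDev s W (w j)} : ℝ)
      ≤ Real.exp (-x) * #(s.powersetCard k) := by
  have : Nonempty ι := ⟨j₀⟩
  have : (0 : ℝ) < k := by exact_mod_cast hk
  have h_nonempty {V : Finset α} (hV : V ∈ s.powersetCard k) := nonempty_of_mem_powersetCard hk hV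
  have h_subset {V : Finset α} (hV : V ∈ s.powersetCard k) := (mem_powersetCard.1 hV).1
  let Z (V : Finset α) : ℝ := θ * r + (supDev s w V + θ * supSq w V)
  have h_le_Z (V : Finset α) : θ * r + supDev s w V ≤ Z V :=
    add_le_add_right (le_add_of_nonneg_right (mul_nonneg hθ.le (supSq_nonneg w V))) _
  have hZ_pos (V) (hV : V ∈ s.powersetCard k) : 0 < Z V := by
    have h_dev := supDev_nonneg (h_nonempty hV) (h_subset hV) hL hj₀
    exact lt_of_lt_of_le (by positivity) (h_le_Z V)
  have h_mean : 𝔼 V ∈ s.powersetCard k, Z V ≤ 𝔼 V ∈ s.powersetCard k, supDev s w V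
      + θ * 𝔼 V ∈ s.powersetCard k, supDev s (w ^ 2) V + 2 * θ * r := by
    rw [mul_expect, ← expect_add_distrib,
      ← expect_const (powersetCard_nonempty.2 hks) (2 * θ * r), ← expect_add_distrib]
    refine expect_le_expect fun V hV => ?_
    have h_sq := supSq_le_supDev_add (h_nonempty hV) (h_subset hV) hL hr
    simp only [Z]
    linarith [mul_le_mul_of_nonneg_left h_sq hθ.le]
  refine le_trans (Nat.cast_le.2 (card_le_card (monotone_filter_right _ fun W hW h => ?_)))
    (card_two_mul_expect_add_lt_le (card_pos.1 (hk.trans hks)) hks hZ_pos (by positivity)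
      (fun W hW => downVar_add_supDev_add_supSq_le hk hθ hL hr hj₀ hW) hx)
  obtain ⟨j, hj⟩ := h
  have h_sup : sampleDev s W (w j) ≤ supDev s w W :=
    le_ciSup (bddAbove_range_sampleDev (h_nonempty hW) (h_subset hW) hL) j
  have h_shift := h_le_Z W
  have h_pos : 0 < θ * r := by positivity
  linarith

end Family

end Suprema

/-! ### Sub-root functions -/

section SubRoot

variable {ψ : ℝ → ℝ} {a r : ℝ}

lemma IsSubRoot.le_sqrt_div_mul (hψ : IsSubRoot ψ) {t : ℝ} (hr : 0 < r) (hrt : r ≤ t) :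
    ψ t ≤ √(t / r) * ψ r := by
  have ht : 0 < t := hr.trans_le hrt
  have h := hψ.anti (Set.mem_Ioi.2 hr) (Set.mem_Ioi.2 ht) hrt
  rw [div_le_iff₀ (Real.sqrt_pos.2 ht)] at h
  rwa [Real.sqrt_div ht.le, div_mul_comm]

lemma IsSubRoot.bddAbove_le_apply (hψ : IsSubRoot ψ) : BddAbove {t | 0 ≤ t ∧ t ≤ ψ t} := by
  refine ⟨max 1 (ψ 1 ^ 2), fun t ⟨_, ht⟩ => ?_⟩
  rcases le_total t 1 with h | h
  · exact h.trans (le_max_left _ _)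
  have h_sqrt : 0 < √t := Real.sqrt_pos.2 (by linarith)
  have h_le : √t * √t ≤ √t * ψ 1 := by
    simpa [Real.mul_self_sqrt (zero_le_one.trans h)]
      using ht.trans (hψ.le_sqrt_div_mul one_pos h)
  exact (Real.sqrt_le_iff.1 (le_of_mul_le_mul_left h_le h_sqrt)).2.trans (le_max_right _ _)

lemma IsSubRoot.le_fixedPoint_of_le_apply (hψ : IsSubRoot ψ) (ha : IsFixedPointOf ψ a) {t : ℝ}
    (ht_nonneg : 0 ≤ t) (ht : t ≤ ψ t) : t ≤ a := by
  set b := sSup {t | 0 ≤ t ∧ t ≤ ψ t}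
  have htb : t ≤ b := le_csSup hψ.bddAbove_le_apply ⟨ht_nonneg, ht⟩
  have hb : 0 ≤ b := ht_nonneg.trans htb
  have h_le : b ≤ ψ b := csSup_le ⟨t, ht_nonneg, ht⟩ fun v hv =>
    hv.2.trans (hψ.mono hv.1 hb (le_csSup hψ.bddAbove_le_apply hv))
  have h_ge : ψ b ≤ b := le_csSup hψ.bddAbove_le_apply
    ⟨hψ.nonneg b hb, hψ.mono hb (hψ.nonneg b hb) h_le⟩
  exact htb.trans (ha.2 ⟨hb, h_ge.antisymm h_le⟩)

lemma IsSubRoot.apply_le_self (hψ : IsSubRoot ψ) (ha : IsFixedPointOf ψ a) (har : a ≤ r) :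
    ψ r ≤ r := by
  by_contra! h
  have h_eq : r = a :=
    (hψ.le_fixedPoint_of_le_apply ha (ha.1.1.trans har) h.le).antisymm har
  rw [h_eq, ha.1.2] at h
  exact h.false

lemma IsSubRoot.sq_apply_le (hψ : IsSubRoot ψ) (ha : IsFixedPointOf ψ a) (hr : 0 < r)
    (har : a ≤ r) : ψ r ^ 2 ≤ a * r := by
  rw [← div_le_iff₀ hr]
  rcases (hψ.nonneg r hr.le).eq_or_lt with h_zero | h_pos
  · simpa [← h_zero] using ha.1.1
  refine hψ.le_fixedPoint_of_le_apply ha (by positivity) ?_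
  have h_ratio : √(r / (ψ r ^ 2 / r)) = r / ψ r := by
    rw [div_div_eq_mul_div, ← sq, ← div_pow, Real.sqrt_sq (by positivity)]
  have h := hψ.le_sqrt_div_mul (show 0 < ψ r ^ 2 / r by positivity)
    (t := r) (by rw [div_le_iff₀ hr, ← sq]; gcongr; exact hψ.apply_le_self ha har)
  rwa [h_ratio, div_mul_eq_mul_div, le_div_iff₀ h_pos, ← sq, ← div_le_iff₀' hr] at h

end SubRoot

/-! ### Peeling -/

section Peeling

/-- The weight by which a function of variance at most `t` is shrunk to variance at most `r`. -/
noncomputable def peelWeight (r t : ℝ) : ℝ :=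
  r / max r t

lemma peelWeight_pos {r : ℝ} (hr : 0 < r) (t : ℝ) : 0 < peelWeight r t :=
  div_pos hr (hr.trans_le (le_max_left r t))

lemma peelWeight_le_one {r : ℝ} (hr : 0 < r) (t : ℝ) : peelWeight r t ≤ 1 :=
  div_le_one_of_le₀ (le_max_left r t) (hr.le.trans (le_max_left r t))

lemma peelWeight_mul_max {r : ℝ} (hr : 0 < r) (t : ℝ) : peelWeight r t * max r t = r :=
  div_mul_cancel₀ r (hr.trans_le (le_max_left r t)).ne'

variable {β : Type*} {D : Set β} {τ p : β → ℝ} {r : ℝ}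

lemma weight_mul_le_sum_iSup {Φ : β → ℝ} (hr : 0 < r) {h₀ : β} (hD₀ : h₀ ∈ D) (hτ₀ : τ h₀ ≤ 0)
    (hΦ₀ : Φ h₀ = 0) (hΦ : BddAbove (Φ '' D)) (hp_nonneg : ∀ h, 0 ≤ p h)
    (hp : ∀ h, p h ≤ peelWeight r (τ h)) {N : ℕ} {h : β} (hD : h ∈ D)
    (hN : max r (τ h) < 4 ^ N * r) :
    p h * Φ h ≤ ∑ n ∈ range N, (1 / 4 : ℝ) ^ n *
      ⨆ g : {g | g ∈ D ∧ τ g ≤ 4 ^ (n + 1) * r}, Φ g := by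
  have h_le_iSup (n : ℕ) (g : β) (hg : g ∈ D) (hgτ : τ g ≤ 4 ^ (n + 1) * r) :
      Φ g ≤ ⨆ g : {g | g ∈ D ∧ τ g ≤ 4 ^ (n + 1) * r}, Φ g :=
    le_ciSup (f := fun g : {g | g ∈ D ∧ τ g ≤ 4 ^ (n + 1) * r} => Φ g)
      (hΦ.mono (Set.range_subset_iff.2 fun g => Set.mem_image_of_mem Φ g.2.1)) ⟨g, hg, hgτ⟩
  have h_term (n : ℕ) :
      0 ≤ (1 / 4 : ℝ) ^ n * ⨆ g : {g | g ∈ D ∧ τ g ≤ 4 ^ (n + 1) * r}, Φ g :=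
    mul_nonneg (by positivity) (hΦ₀.ge.trans (h_le_iSup n h₀ hD₀ (hτ₀.trans (by positivity))))
  obtain ⟨n, hn_le, hn_lt⟩ := exists_nat_pow_near
    ((one_le_div hr).2 (le_max_left r (τ h))) (show (1 : ℝ) < 4 by norm_num)
  rw [le_div_iff₀ hr] at hn_le
  rw [div_lt_iff₀ hr] at hn_lt
  have hnN : n < N := (pow_lt_pow_iff_right₀ (show (1 : ℝ) < 4 by norm_num)).1
    (lt_of_mul_lt_mul_right (hn_le.trans_lt hN) hr.le)
  refine le_trans ?_ (single_le_sum (fun n _ => h_term n) (mem_range.2 hnN))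
  have h_sup := h_le_iSup n h hD ((le_max_right _ _).trans hn_lt.le)
  rcases le_total (Φ h) 0 with h_neg | h_pos
  · exact (mul_nonpos_of_nonneg_of_nonpos (hp_nonneg h) h_neg).trans (h_term n)
  refine mul_le_mul ((hp h).trans ?_) h_sup h_pos (by positivity)
  rw [peelWeight, one_div_pow, div_le_div_iff₀ (hr.trans_le (le_max_left _ _)) (by positivity)]
  linarith

lemma IsSubRoot.sum_mul_apply_le {ψ : ℝ → ℝ} (hψ : IsSubRoot ψ) (hr : 0 < r) (N : ℕ) :
    ∑ n ∈ range N, (1 / 4 : ℝ) ^ n * ψ (4 ^ (n + 1) * r) ≤ 4 * ψ r := by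
  have h_term (n : ℕ) : (1 / 4 : ℝ) ^ n * ψ (4 ^ (n + 1) * r) ≤ 2 * ψ r * (1 / 2) ^ n := by
    have h_scale := hψ.le_sqrt_div_mul hr (t := 4 ^ (n + 1) * r)
      (le_mul_of_one_le_left hr.le (one_le_pow₀ (by norm_num)))
    have h_sqrt : √(4 ^ (n + 1) * r / r) = 2 ^ (n + 1) := by
      rw [mul_div_cancel_right₀ _ hr.ne', show (4 : ℝ) = 2 ^ 2 by norm_num, pow_right_comm]
      exact Real.sqrt_sq (by positivity)
    rw [h_sqrt] at h_scale
    calc (1 / 4 : ℝ) ^ n * ψ (4 ^ (n + 1) * r) ≤ (1 / 4) ^ n * (2 ^ (n + 1) * ψ r) := by gcongr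
      _ = 2 * ψ r * (1 / 4 * 2) ^ n := by rw [mul_pow]; ring
      _ = 2 * ψ r * (1 / 2) ^ n := by norm_num
  have hψ_nonneg := hψ.nonneg r hr.le
  calc ∑ n ∈ range N, (1 / 4 : ℝ) ^ n * ψ (4 ^ (n + 1) * r)
      ≤ 2 * ψ r * ∑ n ∈ range N, (1 / 2 : ℝ) ^ n := by
        rw [mul_sum]
        exact sum_le_sum fun n _ => h_term n
    _ ≤ 2 * ψ r * 2 := by gcongr; exact sum_geometric_two_le N
    _ = 4 * ψ r := by ring

lemma expect_iSup_weight_mul_le {γ : Type*} {P : Finset γ} {Φ : γ → β → ℝ} {ψ : ℝ → ℝ}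
    (hψ : IsSubRoot ψ) (hr : 0 < r) {h₀ : β} (hD₀ : h₀ ∈ D) (hτ₀ : τ h₀ ≤ 0)
    (hτ : BddAbove (τ '' D)) (hΦ₀ : ∀ W ∈ P, Φ W h₀ = 0) (hΦ : ∀ W ∈ P, BddAbove (Φ W '' D))
    (h_local : ∀ t, r ≤ t → 𝔼 W ∈ P, ⨆ h : {h | h ∈ D ∧ τ h ≤ t}, Φ W h ≤ ψ t)
    (hp_nonneg : ∀ h, 0 ≤ p h) (hp : ∀ h, p h ≤ peelWeight r (τ h)) :
    𝔼 W ∈ P, ⨆ h : D, p h * Φ W h ≤ 4 * ψ r := by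
  have : Nonempty D := ⟨⟨h₀, hD₀⟩⟩
  obtain ⟨T, hT⟩ := hτ
  obtain ⟨N, hN⟩ := pow_unbounded_of_one_lt (max r T / r) (show (1 : ℝ) < 4 by norm_num)
  rw [div_lt_iff₀ hr] at hN
  calc 𝔼 W ∈ P, ⨆ h : D, p h * Φ W h
      ≤ 𝔼 W ∈ P, ∑ n ∈ range N, (1 / 4 : ℝ) ^ n *
          ⨆ g : {g | g ∈ D ∧ τ g ≤ 4 ^ (n + 1) * r}, Φ W g :=
        expect_le_expect fun W hW => ciSup_le fun h =>
          weight_mul_le_sum_iSup hr hD₀ hτ₀ (hΦ₀ W hW) (hΦ W hW) hp_nonneg hp h.2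
            ((max_le_max_left r (hT ⟨h, h.2, rfl⟩)).trans_lt hN)
    _ = ∑ n ∈ range N, (1 / 4 : ℝ) ^ n *
          𝔼 W ∈ P, ⨆ g : {g | g ∈ D ∧ τ g ≤ 4 ^ (n + 1) * r}, Φ W g := by
        rw [expect_sum_comm]
        simp only [mul_expect]
    _ ≤ ∑ n ∈ range N, (1 / 4 : ℝ) ^ n * ψ (4 ^ (n + 1) * r) := by
        gcongr with n
        exact h_local _ (le_mul_of_one_le_left hr.le (one_le_pow₀ (by norm_num)))
    _ ≤ 4 * ψ r := hψ.sum_mul_apply_le hr N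

end Peeling

/-! ### Localization -/

section Localization

/-- The radius at which the class is localized: large enough for a sub-root function with fixed
point `a` to be at most a small multiple of the radius there, and for the deviation term of order
`x / k` to be absorbed. -/
noncomputable def localRadius (K L a x : ℝ) (k : ℕ) : ℝ :=
  2 ^ 14 * K ^ 2 * a + (2 ^ 13 * K ^ 2 + 4 * L ^ 2) * x / k

lemma le_localRadius {K L a x : ℝ} (hK : 1 ≤ K) (ha : 0 ≤ a) (hx : 0 ≤ x) (k : ℕ) :
    a ≤ localRadius K L a x k := by
  have hK_sq : 1 ≤ K ^ 2 := one_le_pow₀ hK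
  calc a ≤ 2 ^ 14 * K ^ 2 * a := le_mul_of_one_le_left ha (by linarith)
    _ ≤ localRadius K L a x k := le_add_of_nonneg_right (by positivity)

lemma localRadius_pos {K a x : ℝ} {k : ℕ} (hK : 0 < K) (L : ℝ) (ha : 0 ≤ a) (hx : 0 < x)
    (hk : 1 ≤ k) : 0 < localRadius K L a x k := by
  have : (0 : ℝ) < k := by exact_mod_cast hk
  unfold localRadius
  positivity

lemma IsSubRoot.apply_localRadius_le {ψ : ℝ → ℝ} {K L a x : ℝ} {k : ℕ} (hψ : IsSubRoot ψ)
    (ha : IsFixedPointOf ψ a) (hK : 1 ≤ K) (hx : 0 < x) (hk : 1 ≤ k) :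
    16 * ψ (localRadius K L a x k) ≤ localRadius K L a x k / (8 * K) := by
  have hr := localRadius_pos (zero_lt_one.trans_le hK) L ha.1.1 hx hk
  have h_ge : 2 ^ 14 * K ^ 2 * a ≤ localRadius K L a x k :=
    le_add_of_nonneg_right (by positivity)
  set r := localRadius K L a x k
  have h_sq : ψ r ^ 2 ≤ a * r := hψ.sq_apply_le ha hr (le_localRadius hK ha.1.1 hx.le k)
  have h_abs : |128 * K * ψ r| ≤ |r| := by
    refine sq_le_sq.1 ?_
    calc (128 * K * ψ r) ^ 2 = 2 ^ 14 * K ^ 2 * ψ r ^ 2 := by ring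
      _ ≤ 2 ^ 14 * K ^ 2 * (a * r) := by gcongr
      _ = 2 ^ 14 * K ^ 2 * a * r := by ring
      _ ≤ r ^ 2 := by rw [sq r]; gcongr
  rw [abs_of_pos hr] at h_abs
  rw [le_div_iff₀ (by positivity)]
  linarith [le_of_abs_le h_abs]

lemma deviation_term_le {K L a x : ℝ} {k : ℕ} (hK : 1 ≤ K) (ha : 0 ≤ a) {θ : ℝ}
    (hθ : θ = 1 / (32 * K)) :
    16 * ((4 + 2 * θ ^ 2 * L ^ 2) / (θ * k)) * x ≤ localRadius K L a x k / (4 * K) := by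
  calc 16 * ((4 + 2 * θ ^ 2 * L ^ 2) / (θ * k)) * x = (2048 * K + L ^ 2 / K) * x / k := by
        rw [hθ]
        field_simp
        ring
    _ = (2 ^ 13 * K ^ 2 + 4 * L ^ 2) * x / k / (4 * K) := by
        field_simp
        ring
    _ ≤ localRadius K L a x k / (4 * K) := by
        gcongr
        exact le_add_of_nonneg_left (by positivity)

variable {α β : Type*} {s : Finset α} {k : ℕ} {D : Set β} {v : β → α → ℝ} {τ : β → ℝ} {L r : ℝ}

lemma sampleDev_smul (s W : Finset α) (c : ℝ) (f : α → ℝ) :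
    sampleDev s W (c • f) = c * sampleDev s W f := by
  simp only [sampleDev, Pi.smul_apply, smul_eq_mul, mul_sub, mul_expect]

/-- The family `v` with each member shrunk to variance at most `r`, `τ` bounding the variances. -/
noncomputable def peeled (r : ℝ) (τ : β → ℝ) (v : β → α → ℝ) (h : β) : α → ℝ :=
  peelWeight r (τ h) • v h

lemma abs_peeled_le (hr : 0 < r) {h : β} {i : α} (hL : |v h i| ≤ L) :
    |peeled r τ v h i| ≤ L := by
  rw [peeled, Pi.smul_apply, smul_eq_mul, abs_mul, abs_of_pos (peelWeight_pos hr _)]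
  exact (mul_le_of_le_one_left (abs_nonneg _) (peelWeight_le_one hr _)).trans hL

lemma expect_sq_peeled_le (hr : 0 < r) {h : β} (hvar : 𝔼 i ∈ s, v h i ^ 2 ≤ τ h) :
    𝔼 i ∈ s, peeled r τ v h i ^ 2 ≤ r := by
  have h_pos := peelWeight_pos hr (τ h)
  calc 𝔼 i ∈ s, peeled r τ v h i ^ 2 = peelWeight r (τ h) ^ 2 * 𝔼 i ∈ s, v h i ^ 2 := by
        simp only [peeled, Pi.smul_apply, smul_eq_mul, mul_pow, mul_expect]
    _ ≤ peelWeight r (τ h) * max r (τ h) :=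
        mul_le_mul (pow_le_of_le_one h_pos.le (peelWeight_le_one hr _) two_ne_zero)
          (hvar.trans (le_max_right r _)) (expect_nonneg fun i _ => sq_nonneg _) h_pos.le
    _ = r := peelWeight_mul_max hr _

lemma le_add_div_of_peelWeight_mul_le {t d c : ℝ} (hr : 0 < r) (ht : 0 ≤ t) (hc : 0 < c)
    (h : peelWeight r t * d ≤ r / c) : d ≤ (t + r) / c := by
  have h_max : d ≤ max r t / c := by
    refine le_of_mul_le_mul_left (h.trans_eq ?_) (peelWeight_pos hr t)
    rw [← mul_div_assoc, peelWeight_mul_max hr]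
  refine h_max.trans (div_le_div_of_nonneg_right (max_le ?_ ?_) hc.le) <;> linarith

section Expectation

variable {ψ : ℝ → ℝ} (hψ : IsSubRoot ψ) (hk : 1 ≤ k) (hr : 0 < r)
  (hL : ∀ h ∈ D, ∀ i ∈ s, |v h i| ≤ L) (hτ : BddAbove (τ '' D)) {h₀ : β} (hD₀ : h₀ ∈ D)
  (hτ₀ : τ h₀ ≤ 0) (hv₀ : ∀ i ∈ s, v h₀ i = 0)

include hψ hk hr hL hτ hD₀ hτ₀ hv₀

lemma expect_supDev_smul_le
    (h_local : ∀ t, r ≤ t → 𝔼 W ∈ s.powersetCard k,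
      supDev s (fun h : {h | h ∈ D ∧ τ h ≤ t} => v h) W ≤ ψ t)
    {p : β → ℝ} (hp_nonneg : ∀ h, 0 ≤ p h) (hp : ∀ h, p h ≤ peelWeight r (τ h)) :
    𝔼 W ∈ s.powersetCard k, supDev s (fun h : D => p h • v h) W ≤ 4 * ψ r := by
  simp only [supDev, sampleDev_smul]
  refine expect_iSup_weight_mul_le (Φ := fun W h => sampleDev s W (v h)) hψ hr hD₀ hτ₀ hτ
    (fun W hW => ?_) (fun W hW => ?_) h_local hp_nonneg hp
  · rw [sampleDev, expect_congr rfl fun i hi => hv₀ i ((mem_powersetCard.1 hW).1 hi),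
      expect_congr rfl hv₀]
    simp
  · rw [Set.image_eq_range]
    exact bddAbove_range_sampleDev (w := fun h : D => v h) (nonempty_of_mem_powersetCard hk hW)
      (mem_powersetCard.1 hW).1 fun h => hL h h.2

lemma expect_supDev_peeled_le
    (h_local : ∀ t, r ≤ t → 𝔼 W ∈ s.powersetCard k,
      supDev s (fun h : {h | h ∈ D ∧ τ h ≤ t} => v h) W ≤ ψ t) :
    𝔼 W ∈ s.powersetCard k, supDev s (fun h : D => peeled r τ v h) W ≤ 4 * ψ r :=
  expect_supDev_smul_le (p := fun h => peelWeight r (τ h)) hψ hk hr hL hτ hD₀ hτ₀ hv₀ h_local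
    (fun _ => (peelWeight_pos hr _).le) fun _ => le_rfl

lemma expect_supDev_sq_peeled_le
    (h_local : ∀ t, r ≤ t → 𝔼 W ∈ s.powersetCard k,
      supDev s (fun h : {h | h ∈ D ∧ τ h ≤ t} => v h ^ 2) W ≤ ψ t) :
    𝔼 W ∈ s.powersetCard k, supDev s ((fun h : D => peeled r τ v h) ^ 2) W ≤ 4 * ψ r := by
  have h_sq : (fun h : D => peeled r τ v h) ^ 2
      = fun h : D => peelWeight r (τ h) ^ 2 • v h ^ 2 :=
    funext fun h => smul_pow (peelWeight r (τ h)) (v h) 2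
  rw [h_sq]
  exact expect_supDev_smul_le (v := fun h => v h ^ 2) (p := fun h => peelWeight r (τ h) ^ 2)
    hψ hk hr (fun h hh => abs_sq_apply_le (w := fun h : D => v h) (fun h => hL h h.2) ⟨h, hh⟩)
    hτ hD₀ hτ₀ (fun i hi => by simp [hv₀ i hi]) h_local (fun _ => sq_nonneg _)
    fun _ => pow_le_of_le_one (peelWeight_pos hr _).le (peelWeight_le_one hr _) two_ne_zero

end Expectation

open scoped Classical in
lemma card_exists_localized_lt_sampleDev_le {ψ : ℝ → ℝ} {a K x : ℝ} (hk : 1 ≤ k) (hks : k ≤ #s)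
    (hL : ∀ h ∈ D, ∀ i ∈ s, |v h i| ≤ L) (hτ : BddAbove (τ '' D))
    (hvar : ∀ h ∈ D, 𝔼 i ∈ s, v h i ^ 2 ≤ τ h) {h₀ : β} (hD₀ : h₀ ∈ D) (hτ₀ : τ h₀ ≤ 0)
    (hv₀ : ∀ i ∈ s, v h₀ i = 0) (hψ : IsSubRoot ψ) (ha : IsFixedPointOf ψ a)
    (h_local : ∀ t, a ≤ t → 𝔼 W ∈ s.powersetCard k,
      supDev s (fun h : {h | h ∈ D ∧ τ h ≤ t} => v h) W ≤ ψ t)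
    (h_local_sq : ∀ t, a ≤ t → 𝔼 W ∈ s.powersetCard k,
      supDev s (fun h : {h | h ∈ D ∧ τ h ≤ t} => v h ^ 2) W ≤ ψ t)
    (hK : 1 ≤ K) (hx : 0 < x) :
    (#{W ∈ s.powersetCard k | ∃ h ∈ D,
        (τ h + localRadius K L a x k) / (2 * K) < sampleDev s W (v h)} : ℝ)
      ≤ Real.exp (-x) * #(s.powersetCard k) := by
  have hK_pos : 0 < K := zero_lt_one.trans_le hK
  have hr := localRadius_pos hK_pos L ha.1.1 hx hk
  have har : a ≤ localRadius K L a x k := le_localRadius hK ha.1.1 hx.le k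
  have h_psi := hψ.apply_localRadius_le (L := L) ha hK hx hk
  have h_dev := deviation_term_le (L := L) (x := x) (k := k) hK ha.1.1 rfl
  set r := localRadius K L a x k
  have h_psi_nonneg := hψ.nonneg r hr.le
  have h_mean := expect_supDev_peeled_le hψ hk hr hL hτ hD₀ hτ₀ hv₀
    fun t ht => h_local t (har.trans ht)
  have h_mean_sq := expect_supDev_sq_peeled_le hψ hk hr hL hτ hD₀ hτ₀ hv₀
    fun t ht => h_local_sq t (har.trans ht)
  refine le_trans (Nat.cast_le.2 (card_le_card (monotone_filter_right _ fun W _ => ?_)))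
    (card_exists_lt_sampleDev_le (w := fun h : D => peeled r τ v h) (θ := 1 / (32 * K)) hk hks
      (by positivity) hr (fun h i hi => abs_peeled_le hr (hL h h.2 i hi))
      (fun h => expect_sq_peeled_le hr (hvar h h.2)) (j₀ := ⟨h₀, hD₀⟩)
      (fun i hi => by simp [peeled, hv₀ i hi]) hx)
  rintro ⟨h, hh, h_lt⟩
  refine ⟨⟨h, hh⟩, ?_⟩
  have hτ_nonneg : 0 ≤ τ h := (expect_nonneg fun i _ => sq_nonneg (v h i)).trans (hvar h hh)
  contrapose! h_lt
  refine le_add_div_of_peelWeight_mul_le hr hτ_nonneg (by positivity) ?_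
  rw [peeled, sampleDev_smul] at h_lt
  have h_two_θ : 2 * (1 / (32 * K)) ≤ 2 := by
    rw [mul_one_div, div_le_iff₀ (by positivity)]
    linarith
  have h_sq_term := (mul_le_mul_of_nonneg_left h_mean_sq (by positivity)).trans
    (mul_le_mul_of_nonneg_right h_two_θ (by positivity))
  have h_sum : r / (8 * K) + 4 * (1 / (32 * K)) * r + r / (4 * K) = r / (2 * K) := by
    field_simp
    norm_num
  linarith

end Localization

/-! ### RANDPERM -/

section Uniform

lemma integral_uniformOn_coe {Ω : Type*} [MeasurableSpace Ω] [MeasurableSingletonClass Ω]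
    (s : Finset Ω) (f : Ω → ℝ) : ∫ x, f x ∂uniformOn (s : Set Ω) = 𝔼 x ∈ s, f x := by
  have h_int : IntegrableOn f s Measure.count := by
    rw [← Set.biUnion_of_singleton (s : Set Ω)]
    exact integrableOn_finset_iUnion.2 fun x _ => by simp
  rw [uniformOn, ProbabilityTheory.cond, integral_smul_measure, setIntegral_finset _ h_int,
    Measure.count_apply_finset, expect_eq_sum_div_card, div_eq_inv_mul]
  simp

lemma expect_comp_of_card_fiber_eq {ι κ : Type*} [DecidableEq κ] {s : Finset ι} {t : Finset κ}
    {g : ι → κ} {c : ℕ} (hs : s.Nonempty) (hg : ∀ i ∈ s, g i ∈ t)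
    (hc : ∀ j ∈ t, #{i ∈ s | g i = j} = c) (f : κ → ℝ) :
    𝔼 i ∈ s, f (g i) = 𝔼 j ∈ t, f j := by
  have h_card : #s = #t * c := by
    rw [card_eq_sum_card_fiberwise hg, sum_const_nat hc]
  have hc_ne : (c : ℝ) ≠ 0 := by
    rintro h
    rw [Nat.cast_eq_zero.1 h, mul_zero] at h_card
    exact hs.card_ne_zero h_card
  have h_sum : ∑ i ∈ s, f (g i) = (∑ j ∈ t, f j) * c := by
    rw [← sum_fiberwise_of_maps_to' hg, sum_mul]
    refine sum_congr rfl fun j hj => ?_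
    rw [sum_const, hc j hj, nsmul_eq_mul, mul_comm]
  rw [expect_eq_sum_div_card, expect_eq_sum_div_card, h_sum, h_card, Nat.cast_mul,
    mul_div_mul_right _ _ hc_ne]

lemma card_embedding_map_univ_eq {ι β : Type*} [Fintype ι] [Fintype β]
    [DecidableEq β] {W W' : Finset β} (h : #W = #W') :
    #{e : ι ↪ β | univ.map e = W} = #{e : ι ↪ β | univ.map e = W'} := by
  obtain ⟨σ, rfl⟩ := Equiv.Perm.exists_map_finset_eq W W' h
  refine card_equiv ((Equiv.refl ι).embeddingCongr σ) fun e => ?_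
  simp only [mem_filter_univ]
  have h_map : univ.map ((Equiv.refl ι).embeddingCongr σ e) = (univ.map e).map σ.toEmbedding := by
    rw [map_map]
    rfl
  rw [h_map, map_inj]

lemma expect_map_univ {ι β : Type*} [Fintype ι] [Fintype β] [Nonempty (ι ↪ β)]
    (f : Finset β → ℝ) :
    𝔼 e : ι ↪ β, f (univ.map e) = 𝔼 W ∈ univ.powersetCard (Fintype.card ι), f W := by
  classical
  obtain ⟨e₀⟩ := ‹Nonempty (ι ↪ β)›
  refine expect_comp_of_card_fiber_eq (c := #{e : ι ↪ β | univ.map e = univ.map e₀})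
    ⟨e₀, mem_univ _⟩ (fun e _ => ?_) (fun W hW => ?_) f
  · simp
  · exact card_embedding_map_univ_eq (by simpa using hW)

lemma expect_powersetCard_compl {β : Type*} [Fintype β] [DecidableEq β] {k l : ℕ}
    (hkl : k + l = Fintype.card β) (f : Finset β → ℝ) :
    𝔼 W ∈ univ.powersetCard k, f Wᶜ = 𝔼 W ∈ univ.powersetCard l, f W := by
  refine expect_nbij' compl compl (fun W hW => ?_) (fun W hW => ?_) (fun W _ => compl_compl W)
    (fun W _ => compl_compl W) fun W _ => rfl
  all_goals
    rw [mem_powersetCard_univ] at hW ⊢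
    rw [card_compl]
    omega

end Uniform

section RandPerm

variable {u m : ℕ} {d : Fin u → Fin (u + m)}

lemma permArray_succ (d : Fin u → Fin (u + m)) (i : Fin u) :
    permArray d (i + 1) = permArray d i * Equiv.swap (Fin.castAdd m i) (d i) := by
  rw [permArray, dif_pos i.2]

lemma permArray_castAdd (hd : ∀ i, Fin.castAdd m i ≤ d i) (i : Fin u) {k : ℕ}
    (hik : (i : ℕ) + 1 ≤ k) (hk : k ≤ u) : permArray d k (Fin.castAdd m i) = drawnIndex d i := by
  induction k, hik using Nat.le_induction with
  | base => rw [permArray_succ, Equiv.Perm.mul_apply, Equiv.swap_apply_left, drawnIndex]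
  | succ k hik ih =>
    have h_lt : Fin.castAdd m i < Fin.castAdd m ⟨k, hk⟩ := Fin.lt_def.2 hik
    rw [permArray_succ d ⟨k, hk⟩, Equiv.Perm.mul_apply,
      Equiv.swap_apply_of_ne_of_ne h_lt.ne (h_lt.trans_le (hd ⟨k, hk⟩)).ne, ih (by omega)]

lemma drawnIndex_injective (hd : ∀ i, Fin.castAdd m i ≤ d i) :
    Function.Injective (drawnIndex d) := by
  intro i j hij
  rw [← permArray_castAdd hd i i.2 le_rfl, ← permArray_castAdd hd j j.2 le_rfl] at hij
  exact Fin.castAdd_injective u m ((permArray d u).injective hij)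

lemma injective_drawnIndex :
    Function.Injective (drawnIndex : (Fin u → Fin (u + m)) → Fin u → Fin (u + m)) := by
  intro d d' h
  have h_perm (k : ℕ) (hk : k ≤ u) : permArray d k = permArray d' k := by
    induction k with
    | zero => rfl
    | succ k ih =>
      have h_draw := congrFun h ⟨k, hk⟩
      rw [drawnIndex, drawnIndex, ih (by omega)] at h_draw
      rw [permArray_succ d ⟨k, hk⟩, permArray_succ d' ⟨k, hk⟩, ih (by omega),
        (permArray d' k).injective h_draw]
  funext i
  have h_draw := congrFun h i
  rw [drawnIndex, drawnIndex, h_perm i i.2.le] at h_draw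
  exact (permArray d' i).injective h_draw

/-- The finite set of draws that `drawLaw u m` charges, all with the same mass. -/
def drawSupport (u m : ℕ) : Finset (Fin u → Fin (u + m)) :=
  Fintype.piFinset fun i => Finset.Ici (Fin.castAdd m i)

lemma mem_drawSupport : d ∈ drawSupport u m ↔ ∀ i, Fin.castAdd m i ≤ d i := by
  simp [drawSupport]

lemma drawSupport_nonempty (u m : ℕ) : (drawSupport u m).Nonempty :=
  ⟨fun i => Fin.castAdd m i, mem_drawSupport.2 fun _ => le_rfl⟩

lemma card_drawSupport (u m : ℕ) : #(drawSupport u m) = (u + m).descFactorial u := by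
  rw [drawSupport, Fintype.card_piFinset, Nat.descFactorial_eq_prod_range,
    ← Fin.prod_univ_eq_prod_range]
  simp

lemma drawLaw_eq_uniformOn (u m : ℕ) : drawLaw u m = uniformOn (drawSupport u m : Set _) := by
  rw [drawSupport, Fintype.coe_piFinset, uniformOn_pi, drawLaw]
  simp

instance isProbabilityMeasure_drawLaw (u m : ℕ) : IsProbabilityMeasure (drawLaw u m) := by
  rw [drawLaw_eq_uniformOn]
  exact isProbabilityMeasure_uniformOn (finite_toSet _) (drawSupport_nonempty u m)

lemma ae_drawLaw_mem_drawSupport (u m : ℕ) : ∀ᵐ d ∂drawLaw u m, d ∈ drawSupport u m := by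
  rw [drawLaw_eq_uniformOn]
  exact ae_cond_mem (drawSupport u m).measurableSet

lemma integral_testSet (f : Finset (Fin (u + m)) → ℝ) :
    ∫ d, f (testSet d) ∂drawLaw u m = 𝔼 W ∈ univ.powersetCard u, f W := by
  have h_card : Fintype.card (drawSupport u m) = Fintype.card (Fin u ↪ Fin (u + m)) := by
    rw [Fintype.card_coe, card_drawSupport, Fintype.card_embedding_eq, Fintype.card_fin,
      Fintype.card_fin]
  let toEmbedding (d : drawSupport u m) : Fin u ↪ Fin (u + m) :=
    ⟨drawnIndex d.1, drawnIndex_injective (mem_drawSupport.1 d.2)⟩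
  have h_inj : Function.Injective toEmbedding := fun d d' h =>
    Subtype.ext (injective_drawnIndex (congrArg DFunLike.coe h))
  have : Nonempty (Fin u ↪ Fin (u + m)) := ⟨Fin.castAddEmb m⟩
  calc ∫ d, f (testSet d) ∂drawLaw u m = 𝔼 d ∈ drawSupport u m, f (testSet d) := by
        rw [drawLaw_eq_uniformOn, integral_uniformOn_coe]
    _ = 𝔼 d : drawSupport u m, f (testSet d.1) := by
        rw [expect_eq_sum_div_card, Fintype.expect_eq_sum_div_card,
          sum_coe_sort _ fun d => f (testSet d), Fintype.card_coe]
    _ = 𝔼 e : Fin u ↪ Fin (u + m), f (univ.map e) :=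
        Fintype.expect_bijective toEmbedding
          ((Fintype.bijective_iff_injective_and_card _).2 ⟨h_inj, h_card⟩) _ _ fun d => by
            rw [map_eq_image]
            rfl
    _ = 𝔼 W ∈ univ.powersetCard u, f W := by rw [expect_map_univ, Fintype.card_fin]

lemma integral_trainSet (f : Finset (Fin (u + m)) → ℝ) :
    ∫ d, f (trainSet d) ∂drawLaw u m = 𝔼 W ∈ univ.powersetCard m, f W :=
  (integral_testSet fun W => f Wᶜ).trans
    (expect_powersetCard_compl (Fintype.card_fin (u + m)).symm f)

lemma one_sub_le_drawLaw_real {γ : Type*} {P : Finset γ} {A : (Fin u → Fin (u + m)) → γ}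
    (hA : ∀ f : γ → ℝ, ∫ d, f (A d) ∂drawLaw u m = 𝔼 W ∈ P, f W) {bad : γ → Prop}
    [DecidablePred bad] {p : ℝ} (hP : P.Nonempty) (hbad : (#{W ∈ P | bad W} : ℝ) ≤ p * #P)
    {E : Set (Fin u → Fin (u + m))} (hE : ∀ d ∈ drawSupport u m, ¬bad (A d) → d ∈ E) :
    1 - p ≤ (drawLaw u m).real E := by
  have h_bad : (drawLaw u m).real {d | bad (A d)} ≤ p := by
    rw [← integral_indicator_one (Set.toFinite _).measurableSet]
    calc ∫ d, {d | bad (A d)}.indicator 1 d ∂drawLaw u m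
        = 𝔼 W ∈ P, if bad W then (1 : ℝ) else 0 := by
          rw [← hA]
          simp only [Set.indicator_apply, Set.mem_ofPred_eq, Pi.one_apply]
      _ = #{W ∈ P | bad W} / #P := by rw [expect_eq_sum_div_card, sum_boole]
      _ ≤ p := (div_le_iff₀ (by exact_mod_cast hP.card_pos)).2 hbad
  have h_compl : (drawLaw u m).real Eᶜ ≤ (drawLaw u m).real {d | bad (A d)} := by
    refine ENNReal.toReal_mono (measure_ne_top _ _) (measure_mono_ae ?_)
    filter_upwards [ae_drawLaw_mem_drawSupport u m] with d hd hdE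
    by_contra h
    exact hdE (hE d hd h)
  rw [probReal_compl_eq_one_sub (Set.toFinite E).measurableSet] at h_compl
  linarith

end RandPerm

/-! ### Test and training losses -/

section Halves

variable {α : Type*} [Fintype α] [DecidableEq α] {W : Finset α}

lemma sampleDev_univ_eq (hW : W.Nonempty) (hW_compl : Wᶜ.Nonempty) (v : α → ℝ) :
    sampleDev univ W v = #Wᶜ / (#W + #Wᶜ) * (𝔼 i ∈ W, v i - 𝔼 i ∈ Wᶜ, v i) := by
  have : (0 : ℝ) < #W := by exact_mod_cast hW.card_pos
  have : (0 : ℝ) < #Wᶜ := by exact_mod_cast hW_compl.card_pos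
  have h_card : (#(univ : Finset α) : ℝ) = #W + #Wᶜ := by
    rw [card_univ, ← card_add_card_compl W, Nat.cast_add]
  rw [sampleDev, expect_eq_sum_div_card univ, ← sum_add_sum_compl W, h_card,
    ← card_mul_expect W, ← card_mul_expect Wᶜ]
  field_simp
  ring

lemma expect_sub_expect_compl_le (hW : W.Nonempty) (h_card : #W ≤ #Wᶜ) {v : α → ℝ} {ρ : ℝ}
    (hρ : 0 ≤ ρ) (h : sampleDev univ W v ≤ ρ) : 𝔼 i ∈ W, v i - 𝔼 i ∈ Wᶜ, v i ≤ 2 * ρ := by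
  have h_pos : (0 : ℝ) < #W := by exact_mod_cast hW.card_pos
  have h_le : (#W : ℝ) ≤ #Wᶜ := by exact_mod_cast h_card
  have h_half : (1 / 2 : ℝ) ≤ #Wᶜ / (#W + #Wᶜ) := by
    rw [div_le_div_iff₀ two_pos (by linarith)]
    linarith
  rw [sampleDev_univ_eq hW (card_pos.1 (hW.card_pos.trans_le h_card))] at h
  rcases le_total (𝔼 i ∈ W, v i - 𝔼 i ∈ Wᶜ, v i) 0 with h_neg | h_nonneg
  · exact h_neg.trans (by positivity)
  · linarith [mul_le_mul_of_nonneg_right h_half h_nonneg]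

end Halves

section Loss

variable {α β : Type*} {u m : ℕ} {S : Fin (u + m) → α} {d : Fin u → Fin (u + m)}

lemma card_testSet (hd : d ∈ drawSupport u m) : #(testSet d) = u := by
  rw [testSet, card_image_of_injective _ (drawnIndex_injective (mem_drawSupport.1 hd)), card_fin]

lemma card_trainSet (hd : d ∈ drawSupport u m) : #(trainSet d) = m := by
  rw [trainSet, card_compl, card_testSet hd, Fintype.card_fin, Nat.add_sub_cancel_left]

lemma avgLoss_eq_expect {n : ℕ} (S : Fin n → α) (h : α → ℝ) : avgLoss S h = 𝔼 i, h (S i) := by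
  rw [avgLoss, Fintype.expect_eq_sum_div_card, Fintype.card_fin, one_div_mul_eq_div]

lemma avgSqLoss_eq_expect {n : ℕ} (S : Fin n → α) (h : α → ℝ) :
    avgSqLoss S h = 𝔼 i, h (S i) ^ 2 := by
  rw [avgSqLoss, Fintype.expect_eq_sum_div_card, Fintype.card_fin, one_div_mul_eq_div]

lemma testLoss_eq_expect (hd : d ∈ drawSupport u m) (h : α → ℝ) :
    testLoss S d h = 𝔼 i ∈ testSet d, h (S i) := by
  rw [testLoss, expect_eq_sum_div_card, card_testSet hd, one_div_mul_eq_div]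

lemma trainLoss_eq_expect (hd : d ∈ drawSupport u m) (h : α → ℝ) :
    trainLoss S d h = 𝔼 i ∈ trainSet d, h (S i) := by
  rw [trainLoss, expect_eq_sum_div_card, card_trainSet hd, one_div_mul_eq_div]

lemma testDev_eq_sampleDev (hd : d ∈ drawSupport u m) (h : α → ℝ) :
    testDev S d h = sampleDev univ (testSet d) (h ∘ S) := by
  have h_inj := drawnIndex_injective (mem_drawSupport.1 hd)
  have h_test : 1 / (u : ℝ) * ∑ i, h (S (drawnIndex d i)) = testLoss S d h := by
    rw [testLoss, testSet, sum_image h_inj.injOn]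
  rw [testDev, h_test, testLoss_eq_expect hd, avgLoss_eq_expect]
  rfl

lemma trainDev_eq_sampleDev (hd : d ∈ drawSupport u m) (h : α → ℝ) :
    trainDev S d h = sampleDev univ (trainSet d) (h ∘ S) := by
  rw [trainDev, trainLoss_eq_expect hd, avgLoss_eq_expect]
  rfl

lemma trainDev_neg (h : α → ℝ) : trainDev S d (-h) = -trainDev S d h := by
  simp only [trainDev, trainLoss, avgLoss, Pi.neg_apply, sum_neg_distrib]
  ring

lemma expSup_testDev (H : Set β) (Q : β → α → ℝ) :
    expSup u m H (fun d h => testDev S d (Q h))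
      = 𝔼 W ∈ univ.powersetCard u, supDev univ (fun h : H => Q h ∘ S) W := by
  rw [← integral_testSet, expSup]
  refine integral_congr_ae ?_
  filter_upwards [ae_drawLaw_mem_drawSupport u m] with d hd
  simp only [testDev_eq_sampleDev hd, supDev]

lemma expSup_trainDev (H : Set β) (Q : β → α → ℝ) :
    expSup u m H (fun d h => trainDev S d (Q h))
      = 𝔼 W ∈ univ.powersetCard m, supDev univ (fun h : H => Q h ∘ S) W := by
  rw [← integral_trainSet, expSup]
  refine integral_congr_ae ?_
  filter_upwards [ae_drawLaw_mem_drawSupport u m] with d hd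
  simp only [trainDev_eq_sampleDev hd, supDev]

lemma testLoss_le_of_sampleDev_testSet_le (hu : 1 ≤ u) (hum : u ≤ m) (hd : d ∈ drawSupport u m)
    {h : α → ℝ} {ρ : ℝ} (hρ : 0 ≤ ρ) (h_dev : sampleDev univ (testSet d) (h ∘ S) ≤ ρ) :
    testLoss S d h ≤ trainLoss S d h + 2 * ρ := by
  have h_card := card_testSet hd
  have h_card_compl : #(testSet d)ᶜ = m := card_trainSet hd
  have h_halves := expect_sub_expect_compl_le (card_pos.1 (by omega)) (by omega) hρ h_dev
  rw [testLoss_eq_expect hd, trainLoss_eq_expect hd]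
  exact sub_le_iff_le_add'.1 h_halves

lemma testLoss_le_of_sampleDev_trainSet_le (hm : 1 ≤ m) (hmu : m ≤ u) (hd : d ∈ drawSupport u m)
    {h : α → ℝ} {ρ : ℝ} (hρ : 0 ≤ ρ) (h_dev : sampleDev univ (trainSet d) (-h ∘ S) ≤ ρ) :
    testLoss S d h ≤ trainLoss S d h + 2 * ρ := by
  have h_card := card_trainSet hd
  have h_compl : (trainSet d)ᶜ = testSet d := compl_compl _
  have h_card_compl := card_testSet hd
  rw [← h_compl] at h_card_compl
  have h_halves := expect_sub_expect_compl_le (card_pos.1 (by omega)) (by omega) hρ h_dev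
  rw [testLoss_eq_expect hd, trainLoss_eq_expect hd]
  simp only [h_compl, Function.comp_apply, Pi.neg_apply, expect_neg_distrib] at h_halves
  linarith

end Loss

section LossClass

variable {X Y : Type*} {n : ℕ} {ℓ : ℝ → Y → ℝ} {F : Set (X → ℝ)} {S : Fin n → X × Y}
  {fstar : X → ℝ} {B L : ℝ} {h : X × Y → ℝ}

lemma avgSqLoss_nonneg (S : Fin n → X × Y) (h : X × Y → ℝ) : 0 ≤ avgSqLoss S h := by
  rw [avgSqLoss]
  positivity

lemma avgSqLoss_sub_le (S : Fin n → X × Y) (g h : X × Y → ℝ) :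
    avgSqLoss S (g - h) ≤ 2 * avgSqLoss S g + 2 * avgSqLoss S h := by
  simp only [avgSqLoss_eq_expect, mul_expect, ← expect_add_distrib]
  refine expect_le_expect fun i _ => ?_
  rw [Pi.sub_apply]
  linarith [sq_nonneg (g (S i) + h (S i))]

lemma MainAssumption.mul_avgLoss_nonneg (hM : MainAssumption ℓ F S fstar B) {f : X → ℝ}
    (hf : f ∈ F) : 0 ≤ B * avgLoss S (lossFun ℓ f - lossFun ℓ fstar) :=
  (avgSqLoss_nonneg S _).trans (hM.sq_le f hf)

lemma MainAssumption.surrogateVar_le (hM : MainAssumption ℓ F S fstar B) {f₁ f₂ : X → ℝ}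
    (hf₁ : f₁ ∈ F) (hf₂ : f₂ ∈ F) : surrogateVar ℓ F S fstar B (lossFun ℓ f₁ - lossFun ℓ f₂)
      ≤ 2 * B * avgLoss S (lossFun ℓ f₁ - lossFun ℓ fstar)
        + 2 * B * avgLoss S (lossFun ℓ f₂ - lossFun ℓ fstar) := by
  refine csInf_le ⟨0, ?_⟩ ⟨f₁, hf₁, f₂, hf₂, rfl, rfl⟩
  rintro _ ⟨g₁, hg₁, g₂, hg₂, -, rfl⟩
  linarith [hM.mul_avgLoss_nonneg hg₁, hM.mul_avgLoss_nonneg hg₂]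

lemma MainAssumption.avgSqLoss_le_surrogateVar (hM : MainAssumption ℓ F S fstar B)
    (hh : h ∈ lossDiffClass ℓ F) : avgSqLoss S h ≤ surrogateVar ℓ F S fstar B h := by
  obtain ⟨f₁, hf₁, f₂, hf₂, rfl⟩ := hh
  refine le_csInf ⟨_, f₁, hf₁, f₂, hf₂, rfl, rfl⟩ ?_
  rintro _ ⟨g₁, hg₁, g₂, hg₂, hg, rfl⟩
  rw [← hg, ← sub_sub_sub_cancel_right _ _ (lossFun ℓ fstar)]
  linarith [avgSqLoss_sub_le S (lossFun ℓ g₁ - lossFun ℓ fstar) (lossFun ℓ g₂ - lossFun ℓ fstar),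
    hM.sq_le g₁ hg₁, hM.sq_le g₂ hg₂]

lemma MainAssumption.surrogateVar_nonneg (hM : MainAssumption ℓ F S fstar B)
    (hh : h ∈ lossDiffClass ℓ F) : 0 ≤ surrogateVar ℓ F S fstar B h :=
  (avgSqLoss_nonneg S h).trans (hM.avgSqLoss_le_surrogateVar hh)

lemma MainAssumption.bddAbove_surrogateVar (hn : 0 < n) (hM : MainAssumption ℓ F S fstar B)
    (hL : ∀ h ∈ lossDiffClass ℓ F, ∀ i, |h (S i)| ≤ L) :
    BddAbove (surrogateVar ℓ F S fstar B '' lossDiffClass ℓ F) := by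
  have : NeZero n := ⟨hn.ne'⟩
  have h_term (f) (hf : f ∈ F) : B * avgLoss S (lossFun ℓ f - lossFun ℓ fstar) ≤ |B| * L := by
    refine (le_abs_self _).trans ?_
    rw [abs_mul, avgLoss_eq_expect]
    gcongr
    exact abs_expect_le_of_abs_le univ_nonempty fun i _ => hL _ ⟨f, hf, fstar, hM.mem, rfl⟩ i
  refine ⟨4 * (|B| * L), ?_⟩
  rintro _ ⟨_, ⟨f₁, hf₁, f₂, hf₂, rfl⟩, rfl⟩
  linarith [hM.surrogateVar_le hf₁ hf₂, h_term f₁ hf₁, h_term f₂ hf₂]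

open scoped Classical in
lemma MainAssumption.card_exists_lt_sampleDev_le (hM : MainAssumption ℓ F S fstar B)
    (hL : ∀ h ∈ lossDiffClass ℓ F, ∀ i, |h (S i)| ≤ L) {v : (X × Y → ℝ) → Fin n → ℝ}
    (hv : ∀ h i, |v h i| = |h (S i)|) {k : ℕ} (hk : 1 ≤ k) (hkn : k ≤ n) {ψ : ℝ → ℝ} {a K x : ℝ}
    (hψ : IsSubRoot ψ) (ha : IsFixedPointOf ψ a)
    (h_local : ∀ t, a ≤ t → 𝔼 W ∈ univ.powersetCard k,
      supDev univ (fun h : localClass ℓ F S fstar B t => v h) W ≤ ψ t)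
    (h_local_sq : ∀ t, a ≤ t → 𝔼 W ∈ univ.powersetCard k,
      supDev univ (fun h : localClass ℓ F S fstar B t => (h ^ 2 : X × Y → ℝ) ∘ S) W ≤ ψ t)
    (hK : 1 ≤ K) (hx : 0 < x) :
    (#{W ∈ univ.powersetCard k | ∃ h ∈ lossDiffClass ℓ F,
        (surrogateVar ℓ F S fstar B h + localRadius K L a x k) / (2 * K)
          < sampleDev univ W (v h)} : ℝ)
      ≤ Real.exp (-x) * #((univ : Finset (Fin n)).powersetCard k) := by
  have h_sq (h) : v h ^ 2 = (h ^ 2) ∘ S :=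
    funext fun i => (sq_eq_sq_iff_abs_eq_abs _ _).2 (hv h i)
  refine card_exists_localized_lt_sampleDev_le (v := v) (τ := surrogateVar ℓ F S fstar B) hk
    (by rwa [card_fin]) (fun h hh i _ => (hv h i).trans_le (hL h hh i))
    (hM.bddAbove_surrogateVar (hk.trans hkn) hL) (fun h hh => ?_)
    (h₀ := lossFun ℓ fstar - lossFun ℓ fstar) ⟨fstar, hM.mem, fstar, hM.mem, rfl⟩ ?_
    (fun i _ => ?_) hψ ha h_local (fun t ht => ?_) hK hx
  · refine le_of_eq_of_le ?_ (hM.avgSqLoss_le_surrogateVar hh)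
    rw [avgSqLoss_eq_expect]
    exact expect_congr rfl fun i _ => congrFun (h_sq h) i
  · refine (hM.surrogateVar_le hM.mem hM.mem).trans_eq ?_
    simp [avgLoss]
  · rw [← abs_eq_zero, hv, sub_self, Pi.zero_apply, abs_zero]
  · simp only [h_sq]
    exact h_local_sq t ht

end LossClass

section HighProbability

variable {X Y : Type*} {u m : ℕ} {ℓ : ℝ → Y → ℝ} {F : Set (X → ℝ)} {S : Fin (u + m) → X × Y}
  {fstar : X → ℝ} {B L : ℝ} {ψ : ℝ → ℝ} {a K x : ℝ}

lemma MainAssumption.one_sub_exp_le_drawLaw_real_of_le (hM : MainAssumption ℓ F S fstar B)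
    (hL : ∀ h ∈ lossDiffClass ℓ F, ∀ i, |h (S i)| ≤ L) (hu : 1 ≤ u) (hum : u ≤ m)
    (hψ : IsSubRoot ψ) (ha : IsFixedPointOf ψ a)
    (h_local : ∀ r, a ≤ r → max
      (expSup u m (localClass ℓ F S fstar B r) fun d h => testDev S d h)
      (expSup u m (localClass ℓ F S fstar B r) fun d h => testDev S d (h ^ 2)) ≤ ψ r)
    (hK : 1 ≤ K) (hx : 0 < x) :
    1 - Real.exp (-x) ≤ (drawLaw u m).real {d | ∀ h ∈ lossDiffClass ℓ F, testLoss S d h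
      ≤ trainLoss S d h + (surrogateVar ℓ F S fstar B h + localRadius K L a x u) / K} := by
  classical
  have hK_pos : 0 < K := zero_lt_one.trans_le hK
  have hr := localRadius_pos hK_pos L ha.1.1 hx hu
  refine one_sub_le_drawLaw_real integral_testSet (powersetCard_nonempty.2 (by simp))
    (hM.card_exists_lt_sampleDev_le hL (v := fun h => h ∘ S) (fun _ _ => rfl) hu (by omega) hψ ha
      (fun r hr => ?_) (fun r hr => ?_) hK hx) fun d hd h_good h hh => ?_
  · exact (expSup_testDev _ id).symm.trans_le ((le_max_left _ _).trans (h_local r hr))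
  · exact (expSup_testDev _ fun h => h ^ 2).symm.trans_le
      ((le_max_right _ _).trans (h_local r hr))
  · push Not at h_good
    have h_loss := testLoss_le_of_sampleDev_testSet_le hu hum hd
      (div_nonneg (add_nonneg (hM.surrogateVar_nonneg hh) hr.le) (by positivity)) (h_good h hh)
    rwa [← mul_div_assoc, mul_div_mul_left _ _ two_ne_zero] at h_loss

lemma MainAssumption.one_sub_exp_le_drawLaw_real_of_ge (hM : MainAssumption ℓ F S fstar B)
    (hL : ∀ h ∈ lossDiffClass ℓ F, ∀ i, |h (S i)| ≤ L) (hm : 1 ≤ m) (hmu : m ≤ u)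
    (hψ : IsSubRoot ψ) (ha : IsFixedPointOf ψ a)
    (h_local : ∀ r, a ≤ r → max
      (expSup u m (localClass ℓ F S fstar B r) fun d h => -trainDev S d h)
      (expSup u m (localClass ℓ F S fstar B r) fun d h => trainDev S d (h ^ 2)) ≤ ψ r)
    (hK : 1 ≤ K) (hx : 0 < x) :
    1 - Real.exp (-x) ≤ (drawLaw u m).real {d | ∀ h ∈ lossDiffClass ℓ F, testLoss S d h
      ≤ trainLoss S d h + (surrogateVar ℓ F S fstar B h + localRadius K L a x m) / K} := by
  classical
  have hK_pos : 0 < K := zero_lt_one.trans_le hK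
  have hr := localRadius_pos hK_pos L ha.1.1 hx hm
  refine one_sub_le_drawLaw_real integral_trainSet (powersetCard_nonempty.2 (by simp))
    (hM.card_exists_lt_sampleDev_le hL (v := fun h => -h ∘ S) (fun _ _ => abs_neg _) hm (by omega)
      hψ ha (fun r hr => ?_) (fun r hr => ?_) hK hx) fun d hd h_good h hh => ?_
  · simp only [← trainDev_neg] at h_local
    exact (expSup_trainDev _ fun h => -h).symm.trans_le ((le_max_left _ _).trans (h_local r hr))
  · exact (expSup_trainDev _ fun h => h ^ 2).symm.trans_le
      ((le_max_right _ _).trans (h_local r hr))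
  · push Not at h_good
    have h_loss := testLoss_le_of_sampleDev_trainSet_le hm hmu hd
      (div_nonneg (add_nonneg (hM.surrogateVar_nonneg hh) hr.le) (by positivity)) (h_good h hh)
    rwa [← mul_div_assoc, mul_div_mul_left _ _ two_ne_zero] at h_loss

lemma MainAssumption.surrogateVar_add_localRadius_div_le {n : ℕ} {S : Fin n → X × Y}
    (hM : MainAssumption ℓ F S fstar B) (hK : 0 < K) {f₁ f₂ : X → ℝ} (hf₁ : f₁ ∈ F)
    (hf₂ : f₂ ∈ F) {c : ℝ} (hac : a ≤ c) (k : ℕ) :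
    (surrogateVar ℓ F S fstar B (lossFun ℓ f₁ - lossFun ℓ f₂) + localRadius K L a x k) / K
      ≤ 2 * B / K * (avgLoss S (lossFun ℓ f₁ - lossFun ℓ fstar)
          + avgLoss S (lossFun ℓ f₂ - lossFun ℓ fstar))
        + 2 ^ 14 * K * c + (2 ^ 13 * K + 4 * L ^ 2 / K) * x / k := by
  have h_radius : localRadius K L a x k / K
      = 2 ^ 14 * K * a + (2 ^ 13 * K + 4 * L ^ 2 / K) * x / k := by
    rw [localRadius]
    field_simp
  have h_mono : 2 ^ 14 * K * a ≤ 2 ^ 14 * K * c := by gcongr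
  have h_var := div_le_div_of_nonneg_right (hM.surrogateVar_le hf₁ hf₂) hK.le
  rw [← mul_add, mul_div_right_comm] at h_var
  rw [add_div, h_radius]
  linarith

lemma abs_le_of_mem_lossDiffClass {n : ℕ} {S : Fin n → X × Y}
    (h_loss : ∀ f ∈ F, ∀ i, 0 ≤ lossFun ℓ f (S i) ∧ lossFun ℓ f (S i) ≤ L) {h : X × Y → ℝ}
    (hh : h ∈ lossDiffClass ℓ F) (i : Fin n) : |h (S i)| ≤ L := by
  obtain ⟨f₁, hf₁, f₂, hf₂, rfl⟩ := hh
  exact abs_sub_le_of_nonneg_of_le (h_loss f₁ hf₁ i).1 (h_loss f₁ hf₁ i).2 (h_loss f₂ hf₂ i).1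
    (h_loss f₂ hf₂ i).2

end HighProbability

end TLC

theorem mainTheorem7_general {X Y : Type*} {u m : ℕ} (hu : 1 ≤ u) (hm : 1 ≤ m)
    {S : Fin (u + m) → X × Y} {ℓ : ℝ → Y → ℝ} {F : Set (X → ℝ)} {fstar : X → ℝ} {B L K : ℝ}
    (hL : ∀ h ∈ TLC.lossDiffClass ℓ F, ∀ i, |h (S i)| ≤ L)
    (hM : TLC.MainAssumption ℓ F S fstar B) (hK : 1 ≤ K) {ψu ψm : ℝ → ℝ} {ru rm : ℝ}
    (hψu : TLC.IsSubRoot ψu) (hru : TLC.IsFixedPointOf ψu ru)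
    (hψm : TLC.IsSubRoot ψm) (hrm : TLC.IsFixedPointOf ψm rm)
    (h_test : ∀ r, ru ≤ r → max
      (TLC.expSup u m (TLC.localClass ℓ F S fstar B r) fun d h => TLC.testDev S d h)
      (TLC.expSup u m (TLC.localClass ℓ F S fstar B r) fun d h => TLC.testDev S d (h ^ 2)) ≤ ψu r)
    (h_train : ∀ r, rm ≤ r → max
      (TLC.expSup u m (TLC.localClass ℓ F S fstar B r) fun d h => -TLC.trainDev S d h)
      (TLC.expSup u m (TLC.localClass ℓ F S fstar B r) fun d h => TLC.trainDev S d (h ^ 2)) ≤ ψm r)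
    {x : ℝ} (hx : 0 < x) :
    1 - Real.exp (-x) ≤ (TLC.drawLaw u m).real
      {d | ∀ h ∈ TLC.lossDiffClass ℓ F, ∀ f₁ ∈ F, ∀ f₂ ∈ F,
        h = TLC.lossFun ℓ f₁ - TLC.lossFun ℓ f₂ →
        TLC.testLoss S d h ≤ TLC.trainLoss S d h
          + 2 * B / K * (TLC.avgLoss S (TLC.lossFun ℓ f₁ - TLC.lossFun ℓ fstar)
              + TLC.avgLoss S (TLC.lossFun ℓ f₂ - TLC.lossFun ℓ fstar))
          + 2 ^ 14 * K * (ru + rm) + (2 ^ 13 * K + 4 * L ^ 2 / K) * x / (min m u : ℝ)} := by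
  have hK_pos : 0 < K := zero_lt_one.trans_le hK
  rcases le_total u m with hum | hmu
  · refine (hM.one_sub_exp_le_drawLaw_real_of_le hL hu hum hψu hru h_test hK hx).trans
      (measureReal_mono fun d hd => ?_)
    rintro h hh f₁ hf₁ f₂ hf₂ rfl
    rw [min_eq_right (Nat.cast_le.2 hum)]
    linarith [hd _ hh, hM.surrogateVar_add_localRadius_div_le (L := L) (x := x) hK_pos hf₁ hf₂
      (le_add_of_nonneg_right hrm.1.1 : ru ≤ ru + rm) u]
  · refine (hM.one_sub_exp_le_drawLaw_real_of_ge hL hm hmu hψm hrm h_train hK hx).trans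
      (measureReal_mono fun d hd => ?_)
    rintro h hh f₁ hf₁ f₂ hf₂ rfl
    rw [min_eq_left (Nat.cast_le.2 hmu)]
    linarith [hd _ hh, hM.surrogateVar_add_localRadius_div_le (L := L) (x := x) hK_pos hf₁ hf₂
      (le_add_of_nonneg_left hru.1.1 : rm ≤ ru + rm) m]

theorem mainTheorem7 (K : ℝ) (hK : 1 < K) :
    ∃ c₀ : ℝ, 0 < c₀ ∧ ∀ L₀ : ℝ, 2 * Real.sqrt 2 ≤ L₀ → ∃ c₁ : ℝ, 0 < c₁ ∧
      ∀ (u m : ℕ), 1 ≤ u → 1 ≤ m →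
      ∀ (dim : ℕ) (X : Set (EuclideanSpace ℝ (Fin dim))) (Y : Set ℝ)
        (S : Fin (u + m) → X × Y) (ℓ : ℝ → Y → ℝ) (F : Set (X → ℝ)),
      (∀ f ∈ F, ∀ i, 0 ≤ TLC.lossFun ℓ f (S i) ∧ TLC.lossFun ℓ f (S i) ≤ L₀) →
      ∀ (fstar : X → ℝ) (B : ℝ), TLC.MainAssumption ℓ F S fstar B →
      ∀ (ψu ψm : ℝ → ℝ) (ru rm : ℝ),
      TLC.IsSubRoot ψu → TLC.IsFixedPointOf ψu ru →
      TLC.IsSubRoot ψm → TLC.IsFixedPointOf ψm rm →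
      (∀ r, ru ≤ r →
        max
          (TLC.expSup u m (TLC.localClass ℓ F S fstar B r) fun d h => TLC.testDev S d h)
          (TLC.expSup u m (TLC.localClass ℓ F S fstar B r) fun d h => TLC.testDev S d (h ^ 2))
        ≤ ψu r) →
      (∀ r, rm ≤ r →
        max
          (TLC.expSup u m (TLC.localClass ℓ F S fstar B r) fun d h => -TLC.trainDev S d h)
          (TLC.expSup u m (TLC.localClass ℓ F S fstar B r) fun d h => TLC.trainDev S d (h ^ 2))
        ≤ ψm r) →
      ∀ x : ℝ, 0 < x →
        1 - Real.exp (-x) ≤ (TLC.drawLaw u m).real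
          {d | ∀ h ∈ TLC.lossDiffClass ℓ F, ∀ f₁ ∈ F, ∀ f₂ ∈ F,
            h = TLC.lossFun ℓ f₁ - TLC.lossFun ℓ f₂ →
            TLC.testLoss S d h ≤ TLC.trainLoss S d h
              + 2 * B / K * (TLC.avgLoss S (TLC.lossFun ℓ f₁ - TLC.lossFun ℓ fstar)
                  + TLC.avgLoss S (TLC.lossFun ℓ f₂ - TLC.lossFun ℓ fstar))
              + c₀ * (ru + rm) + c₁ * x / (min m u : ℝ)} := by
  refine ⟨2 ^ 14 * K, by positivity, fun L₀ _ => ⟨2 ^ 13 * K + 4 * L₀ ^ 2 / K, by positivity, ?_⟩⟩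
  intro u m hu hm dim X Y S ℓ F h_loss fstar B hM ψu ψm ru rm hψu hru hψm hrm h_test h_train x hx
  exact mainTheorem7_general hu hm (fun _ => TLC.abs_le_of_mem_lossDiffClass h_loss) hM hK.le
    hψu hru hψm hrm h_test h_train hx
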